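/- Let $k,l$ be positive integers and $n=k+l$. Let $\sigma_1,\dots,\sigma_k$ and $q$ be indeterminates, put $\sigma_0=1$ and $\sigma_i=0$ for $i<0$ or $i>k$, let $Y_p=\det(\sigma_{1+j-i})_{1\le i,j\le p}$, and set $$\Lambda(l,k)=\mathbb Z[q,\sigma_1,\dots,\sigma_k]/\bigl(Y_{l+1},\dots,Y_{n-1},\,Y_n+(-1)^kq\bigr).$$ For a partition $\lambda=(\lambda_1,\dots,\lambda_r)$ let $\sigma_\lambda\in\Lambda(l,k)$ be the class of $\det(\sigma_{\lambda_i+j-i})_{1\le i,j\le r}$. Write $\lambda\subset l\times k$ if the Young diagram of $\lambda$ fits in the rectangle with $l$ rows and $k$ columns. For $\nu\subset l\times k$ and $m\ge 0$ let $\nu[m]$ be the partition obtained from $\nu$ by successively adding $m$ rim hooks with $n$ boxes each, every one starting in the first column and ending in the $k$-th column. For partitions $\lambda\subset\varrho$ with $\varrho_1\le k$, a semistandard tableau $T$ on $\varrho/\lambda$ (weakly increasing along rows, strictly increasing down columns) is called proper if, for each entry $i$ of $T$ in the first column and in row $l+p$ with $p\ge 1$, the box in the $k$-th column and row $p$ is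 either in $\lambda$, or is in $\varrho/\lambda$ and has an entry of $T$ that is at most $i$. For $\lambda,\nu\subset l\times k$ and a sequence $\mu=(\mu_1,\dots,\mu_r)$ of integers with $0\le\mu_i\le k$ such that $|\lambda|+\sum_i\mu_i=|\nu|+mn$ for some $m\ge 0$, let $K_{\lambda\mu}^{\nu}(l,k)$ be the number of proper semistandard tableaux on $\nu[m]/\lambda$ of content $\mu$, i.e. with $\mu_i$ entries equal to $i$ for $1\le i\le r$ and no other entries (this number is $0$ if $\lambda\not\subset\nu[m]$). Proposition. For every $\lambda\subset l\times k$ and all $0\le\mu_1,\dots,\mu_r\le k$, in $\Lambda(l,k)$, $$\sigma_{\mu_r}\cdots\sigma_{\mu_1}\cdot\sigma_\lambda=\sum K_{\lambda\mu}^{\nu}(l,k)\,q^m\,\sigma_\nu,$$ the sum over all $\nu\subset l\times k$ and $m\ge 0$ with $|\nu|+mn=|\lambda|+\sum_i\mu_i$. In particular $K_{\lambda\mu}^{\nu}(l,k)$ does not depend on the order of the terms of $\mu=(\mu_1,\dots,\mu_r)$. -/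

import Mathlib

/-! Conventions: a partition is a Mathlib `YoungDiagram`; boxes are pairs `(row, column)`, both
counted from `0`. Throughout `n = l + k`. -/

namespace QuantumKostka

section Ring

/-- The polynomial `σ_i ∈ ℤ[q][σ_1, …, σ_k]` for an arbitrary integer index: `σ_0 = 1`, the variable
`σ_i` for `1 ≤ i ≤ k`, and `0` for `i < 0` and for `i > k`. The variable `σ_i` is `X (i - 1)`, and
`q` is the variable of the coefficient ring `Polynomial ℤ`. -/
noncomputable def sigmaPoly (k : ℕ) (i : ℤ) : MvPolynomial (Fin k) (Polynomial ℤ) :=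
  if i = 0 then 1
  else if h : 1 ≤ i ∧ i ≤ k then MvPolynomial.X ⟨(i - 1).toNat, by omega⟩
  else 0

/-- `Y_p = det (σ_{1+j-i})_{1 ≤ i,j ≤ p}`. -/
noncomputable def Y (k p : ℕ) : MvPolynomial (Fin k) (Polynomial ℤ) :=
  Matrix.det (Matrix.of fun i j : Fin p => sigmaPoly k (1 + (j : ℤ) - (i : ℤ)))

/-- The polynomial `q`. -/
noncomputable def qPoly (k : ℕ) : MvPolynomial (Fin k) (Polynomial ℤ) :=
  MvPolynomial.C Polynomial.X

/-- The ideal `(Y_{l+1}, …, Y_{n-1}, Y_n + (-1)^k q)`, where `n = l + k`. -/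
noncomputable def relations (l k : ℕ) : Ideal (MvPolynomial (Fin k) (Polynomial ℤ)) :=
  Ideal.span ({f | ∃ p : ℕ, l + 1 ≤ p ∧ p ≤ l + k - 1 ∧ f = Y k p} ∪
    {Y k (l + k) + (-1) ^ k * qPoly k})

/-- The ring `Λ(l,k) = ℤ[q, σ_1, …, σ_k] / (Y_{l+1}, …, Y_{n-1}, Y_n + (-1)^k q)`. -/
abbrev Lam (l k : ℕ) : Type :=
  MvPolynomial (Fin k) (Polynomial ℤ) ⧸ relations l k

/-- The class of `q` in `Λ(l,k)`. -/
noncomputable def q (l k : ℕ) : Lam l k := Ideal.Quotient.mk (relations l k) (qPoly k)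

/-- The class of `σ_i` in `Λ(l,k)`. -/
noncomputable def sigma (l k : ℕ) (i : ℤ) : Lam l k :=
  Ideal.Quotient.mk (relations l k) (sigmaPoly k i)

/-- `σ_λ = det (σ_{λ_i+j-i})_{1 ≤ i,j ≤ r}` in `Λ(l,k)`, where `r` is the number of rows of `λ`. -/
noncomputable def sigmaShape (l k : ℕ) (lam : YoungDiagram) : Lam l k :=
  Matrix.det (Matrix.of fun i j : Fin (lam.colLen 0) =>
    sigma l k ((lam.rowLen i : ℤ) + (j : ℤ) - (i : ℤ)))

end Ring

section Shapes

/-- `λ ⊂ l × k`: the diagram lies in the rectangle with `l` rows and `k` columns. -/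
def InBox (l k : ℕ) (lam : YoungDiagram) : Prop :=
  lam.cells ⊆ Finset.range l ×ˢ Finset.range k

theorem finite_inBox (l k : ℕ) : {lam : YoungDiagram | InBox l k lam}.Finite := by
  refine Set.Finite.of_finite_image (f := YoungDiagram.cells)
    (Set.Finite.subset (Finset.range l ×ˢ Finset.range k).powerset.finite_toSet ?_) ?_
  · rintro _ ⟨lam, h, rfl⟩
    exact Finset.mem_coe.2 (Finset.mem_powerset.2 h)
  · intro a _ b _ h
    exact YoungDiagram.ext h

/-- The finite set of all partitions `ν ⊂ l × k`. -/
noncomputable def boxShapes (l k : ℕ) : Finset YoungDiagram := (finite_inBox l k).toFinset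

@[simp] theorem mem_boxShapes {l k : ℕ} {lam : YoungDiagram} :
    lam ∈ boxShapes l k ↔ InBox l k lam := by
  simp [boxShapes]

/-- The rim hook of `ρ` corresponding to the box `(a, b)`: the part of the rim of `ρ` lying weakly
below and weakly to the right of that box. It runs from the last box of column `b` to the last box
of row `a`. -/
def rimHook (rho : YoungDiagram) (a b : ℕ) : Finset (ℕ × ℕ) :=
  rho.cells.filter fun c => a ≤ c.1 ∧ b ≤ c.2 ∧ (c.1 + 1, c.2 + 1) ∉ rho.cells

/-- `ρ` is obtained from `ν` by adding a rim `n`-hook (`n = l + k`) that starts in the first column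
and ends in the `k`-th column. -/
def AddsFullRim (l k : ℕ) (nu rho : YoungDiagram) : Prop :=
  ∃ a : ℕ, rho.rowLen a = k ∧ (rimHook rho a 0).card = l + k ∧
    nu.cells = rho.cells \ rimHook rho a 0

/-- The diagram obtained from `ν` by adding a rim `n`-hook from the first to the `k`-th column,
given explicitly: the smallest diagram that contains a first row of `k` boxes, the box of the first
column that is `l` rows below the first free box of the `k`-th column of `ν`, and `ν` moved by one
step along the diagonal and cut off after column `k`. See `addsFullRim_iff`. -/
def addFullRim (l k : ℕ) (nu : YoungDiagram) : YoungDiagram where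
  cells := (Finset.range (nu.colLen 0 + nu.colLen (k - 1) + l + 2) ×ˢ Finset.range k).filter
    fun c => c.1 = 0 ∨ (c.2 = 0 ∧ c.1 ≤ nu.colLen (k - 1) + l) ∨ (c.1 - 1, c.2 - 1) ∈ nu
  isLowerSet := by
    rintro ⟨i, j⟩ ⟨i', j'⟩ hle h
    obtain ⟨h1, h2⟩ := Prod.mk_le_mk.1 hle
    simp only [Finset.coe_filter, Finset.mem_product, Finset.mem_range, Set.mem_ofPred_eq] at h ⊢
    refine ⟨⟨by omega, by omega⟩, ?_⟩
    rcases h.2 with h3 | h3 | h3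
    · left; omega
    · right; left; omega
    · right; right
      exact nu.up_left_mem (by omega) (by omega) h3

/-- The partition `ν[m]`, obtained from `ν` by adding `m` rim `n`-hooks, each starting in the first
column and ending in the `k`-th column. See `addsFullRim_addRims_iff`. -/
def addRims (l k m : ℕ) (nu : YoungDiagram) : YoungDiagram := (addFullRim l k)^[m] nu

end Shapes

section Tableaux

/-- A filling of the boxes of `ρ/λ` by `1, …, r` (here `Fin r`) that is weakly increasing along rows
and strictly increasing down columns. -/
def IsSemistandard {lam rho : YoungDiagram} {r : ℕ}
    (T : ↥(rho.cells \ lam.cells) → Fin r) : Prop :=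
  (∀ c d : ↥(rho.cells \ lam.cells), c.1.1 = d.1.1 → c.1.2 < d.1.2 → T c ≤ T d) ∧
  (∀ c d : ↥(rho.cells \ lam.cells), c.1.2 = d.1.2 → c.1.1 < d.1.1 → T c < T d)

/-- The filling has content `μ`: the `i`-th letter occurs `μ_i` times. -/
def HasContent {lam rho : YoungDiagram} {r : ℕ}
    (T : ↥(rho.cells \ lam.cells) → Fin r) (mu : Fin r → ℕ) : Prop :=
  ∀ i, (Finset.univ.filter fun c => T c = i).card = mu i

/-- `T` is proper: for each box of `ρ/λ` in the first column and in row `l + p` (rows counted from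
`0`, so `p ≥ 0`), the box in row `p` of the `k`-th column is in `λ`, or it is in `ρ/λ` and its entry
is at most the entry of the given box. -/
def IsProper (l k : ℕ) {lam rho : YoungDiagram} {r : ℕ}
    (T : ↥(rho.cells \ lam.cells) → Fin r) : Prop :=
  ∀ (c : ↥(rho.cells \ lam.cells)) (p : ℕ), c.1 = (l + p, 0) →
    (p, k - 1) ∈ lam ∨ ∃ d : ↥(rho.cells \ lam.cells), d.1 = (p, k - 1) ∧ T d ≤ T c

/-- The quantum Kostka number `K_{λμ}^ν(l,k)`: the number of proper semistandard tableaux on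
`ν[m]/λ` with content `μ`, where `m` is the number with `|λ| + ∑ μ_i = |ν| + m n`; it is carried as
an argument. There is no tableau on `ν[m]/λ` unless `λ ⊂ ν[m]`. -/
noncomputable def quantumKostka (l k : ℕ) {r : ℕ} (lam : YoungDiagram) (mu : Fin r → ℕ)
    (nu : YoungDiagram) (m : ℕ) : ℕ :=
  Nat.card {T : ↥((addRims l k m nu).cells \ lam.cells) → Fin r //
    lam ≤ addRims l k m nu ∧ IsSemistandard T ∧ HasContent T mu ∧ IsProper l k T}

end Tableaux

section RimFacts

theorem ext_colLen {a b : YoungDiagram} (h : ∀ j, a.colLen j = b.colLen j) : a = b := by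
  ext ⟨i, j⟩
  rw [YoungDiagram.mem_cells, YoungDiagram.mem_cells, YoungDiagram.mem_iff_lt_colLen,
    YoungDiagram.mem_iff_lt_colLen, h j]

theorem card_eq_sum_colLen (a : YoungDiagram) (k : ℕ) (h : ∀ c ∈ a.cells, c.2 < k) :
    a.card = ∑ j ∈ Finset.range k, a.colLen j := by
  rw [YoungDiagram.card, Finset.card_eq_sum_card_fiberwise (f := Prod.snd) (t := Finset.range k)]
  · refine Finset.sum_congr rfl fun j _ => ?_
    rw [YoungDiagram.colLen_eq_card]
    rfl
  · intro c hc
    simpa using h c hc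

theorem mem_addFullRim {l k : ℕ} {nu : YoungDiagram} {i j : ℕ} :
    (i, j) ∈ addFullRim l k nu ↔
      j < k ∧ (i = 0 ∨ (j = 0 ∧ i ≤ nu.colLen (k - 1) + l) ∨ (i - 1, j - 1) ∈ nu) := by
  rw [← YoungDiagram.mem_cells]
  simp only [addFullRim, Finset.mem_filter, Finset.mem_product, Finset.mem_range]
  constructor
  · rintro ⟨⟨_, h1⟩, h2⟩
    exact ⟨h1, h2⟩
  · rintro ⟨h1, h2⟩
    refine ⟨⟨?_, h1⟩, h2⟩
    rcases h2 with h2 | h2 | h2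
    · omega
    · omega
    · rw [YoungDiagram.mem_iff_lt_colLen] at h2
      have := nu.colLen_anti 0 (j - 1) (by omega)
      omega

theorem colLen_eq_of_mem_iff {a : YoungDiagram} {j N : ℕ} (h : ∀ i, (i, j) ∈ a ↔ i < N) :
    a.colLen j = N := by
  have h' : ∀ i, i < a.colLen j ↔ i < N := fun i => by
    rw [← YoungDiagram.mem_iff_lt_colLen, h i]
  have h1 := h' N
  have h2 := h' (a.colLen j)
  omega

/-- The column lengths of a diagram with one full-width rim hook added. -/
theorem colLen_addFullRim {l k : ℕ} (hk : 0 < k) {nu : YoungDiagram}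
    (hh : nu.colLen 0 ≤ nu.colLen (k - 1) + l) (j : ℕ) :
    (addFullRim l k nu).colLen j =
      if j = 0 then nu.colLen (k - 1) + l + 1 else if j < k then nu.colLen (j - 1) + 1 else 0 := by
  apply colLen_eq_of_mem_iff
  intro i
  rw [mem_addFullRim, YoungDiagram.mem_iff_lt_colLen]
  rcases Nat.eq_zero_or_pos j with rfl | hj
  · simp only [if_true, Nat.zero_sub, hk, true_and]
    omega
  · split_ifs <;> omega

/-- The explicit diagram is the one and only diagram obtained by adding a rim `n`-hook from the
first to the `k`-th column. -/
theorem addsFullRim_iff {l k : ℕ} (hk : 0 < k) {nu rho : YoungDiagram}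
    (hw : ∀ c ∈ nu.cells, c.2 < k) (hh : nu.colLen 0 ≤ nu.colLen (k - 1) + l) :
    AddsFullRim l k nu rho ↔ rho = addFullRim l k nu := by
  have hcard := card_eq_sum_colLen nu k hw
  have key : (∀ c ∈ rho.cells, c.2 < k) →
      (∀ j, j + 1 < k → rho.colLen (j + 1) = nu.colLen j + 1) →
      rho.card + nu.colLen (k - 1) + 1 = nu.card + rho.colLen 0 + k := by
    intro h1 h2
    obtain ⟨k', rfl⟩ : ∃ k', k = k' + 1 := ⟨k - 1, by omega⟩
    rw [card_eq_sum_colLen rho _ h1, hcard, Finset.sum_range_succ', Finset.sum_range_succ,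
      Finset.sum_congr rfl fun j hj => h2 j (by simpa using hj), Finset.sum_add_distrib]
    simp
    omega
  constructor
  · rintro ⟨a, ha, hn, hcells⟩
    have hrow : ∀ j, a < rho.colLen j ↔ j < k := fun j => by
      rw [← YoungDiagram.mem_iff_lt_colLen, YoungDiagram.mem_iff_lt_rowLen, ha]
    have hmem : ∀ i j, i < nu.colLen j ↔
        i < rho.colLen j ∧ (i < a ∨ i + 1 < rho.colLen (j + 1)) := by
      intro i j
      rw [← YoungDiagram.mem_iff_lt_colLen, ← YoungDiagram.mem_cells, hcells]
      simp only [rimHook, Finset.mem_sdiff, Finset.mem_filter, YoungDiagram.mem_cells,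
        YoungDiagram.mem_iff_lt_colLen]
      omega
    have hcols : ∀ j, k ≤ j → rho.colLen j = 0 := by
      intro j hj
      by_contra hne
      have h1 : ¬ a < rho.colLen j := fun h => by have := (hrow j).1 h; omega
      have h2 : (0, j) ∈ nu.cells := by
        rw [YoungDiagram.mem_cells, YoungDiagram.mem_iff_lt_colLen, hmem]
        omega
      have := hw _ h2
      omega
    have hmid : ∀ j, j + 1 < k → rho.colLen (j + 1) = nu.colLen j + 1 := by
      intro j hj
      have h1 := (hrow (j + 1)).2 hj
      have h2 := rho.colLen_anti j (j + 1) (by omega)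
      have h3 := hmem (nu.colLen j) j
      have h4 := hmem (rho.colLen (j + 1) - 1) j
      have h5 := hmem (rho.colLen (j + 1) - 2) j
      omega
    have hlast : nu.colLen (k - 1) = a := by
      have h1 := (hrow (k - 1)).2 (by omega)
      have h2 := hcols k le_rfl
      have h3 := hmem (nu.colLen (k - 1)) (k - 1)
      have h4 := hmem a (k - 1)
      have h5 := hmem (a - 1) (k - 1)
      rw [show k - 1 + 1 = k by omega] at h3 h4 h5
      omega
    have hwr : ∀ c ∈ rho.cells, c.2 < k := by
      rintro ⟨i, j⟩ hc
      by_contra hj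
      rw [YoungDiagram.mem_cells, YoungDiagram.mem_iff_lt_colLen, hcols j (by simpa using hj)] at hc
      omega
    have hsz : nu.card + (l + k) = rho.card := by
      rw [← hn, YoungDiagram.card, YoungDiagram.card, hcells]
      exact Finset.card_sdiff_add_card_eq_card (Finset.filter_subset _ _)
    have := key hwr hmid
    apply ext_colLen
    intro j
    rw [colLen_addFullRim hk hh]
    split_ifs with h1 h2
    · subst h1; omega
    · have := hmid (j - 1) (by omega)
      rwa [show j - 1 + 1 = j by omega] at this
    · exact hcols j (by omega)
  · intro hrho
    have hcol : ∀ j, rho.colLen j = if j = 0 then nu.colLen (k - 1) + l + 1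
        else if j < k then nu.colLen (j - 1) + 1 else 0 := by
      intro j
      rw [hrho, colLen_addFullRim hk hh]
    have hanti := nu.colLen_anti
    have hnu : ∀ j, k ≤ j → nu.colLen j = 0 := by
      intro j hj
      by_contra hne
      have : (0, j) ∈ nu.cells := by
        rw [YoungDiagram.mem_cells, YoungDiagram.mem_iff_lt_colLen]; omega
      have := hw _ this
      omega
    have hsub : nu.cells = rho.cells \ rimHook rho (nu.colLen (k - 1)) 0 := by
      ext ⟨i, j⟩
      simp only [rimHook, Finset.mem_sdiff, Finset.mem_filter, YoungDiagram.mem_cells,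
        YoungDiagram.mem_iff_lt_colLen, hcol]
      have h1 := hnu j
      have h2 := hanti (j - 1) j (by omega)
      have h3 : j < k → nu.colLen (k - 1) ≤ nu.colLen j := fun h => hanti j (k - 1) (by omega)
      by_cases hj : j + 1 < k
      · simp only [hj, if_true, Nat.add_sub_cancel, Nat.succ_ne_zero, if_false, Nat.zero_le,
          true_and]
        have h3 := h3 (by omega)
        split_ifs with h4
        · subst h4; omega
        · omega
        · omega
      · simp only [hj, if_false, Nat.succ_ne_zero, Nat.zero_le, true_and]
        by_cases hjk : j < k
        · obtain rfl : j = k - 1 := by omega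
          split_ifs with h4 <;> omega
        · have := h1 (by omega)
          split_ifs with h4 <;> omega
    have hwr : ∀ c ∈ rho.cells, c.2 < k := by
      rintro ⟨i, j⟩ hc
      rw [hrho, YoungDiagram.mem_cells, mem_addFullRim] at hc
      exact hc.1
    refine ⟨nu.colLen (k - 1), ?_, ?_, hsub⟩
    · have hrow : ∀ j, j < rho.rowLen (nu.colLen (k - 1)) ↔ j < k := by
        intro j
        rw [← YoungDiagram.mem_iff_lt_rowLen, YoungDiagram.mem_iff_lt_colLen, hcol]
        have h3 : j < k → nu.colLen (k - 1) ≤ nu.colLen (j - 1) :=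
          fun h => hanti (j - 1) (k - 1) (by omega)
        split_ifs <;> omega
      have h1 := hrow k
      have h2 := hrow (rho.rowLen (nu.colLen (k - 1)))
      omega
    · have h1 : nu.card + (rimHook rho (nu.colLen (k - 1)) 0).card = rho.card := by
        rw [YoungDiagram.card, YoungDiagram.card, hsub]
        exact Finset.card_sdiff_add_card_eq_card (Finset.filter_subset _ _)
      have h2 := key hwr fun j hj => by rw [hcol]; simp [hj]
      have h3 := hcol 0
      simp only [if_true] at h3
      omega

theorem addRims_bounds {l k : ℕ} (hk : 0 < k) {nu : YoungDiagram} (h : InBox l k nu) (m : ℕ) :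
    (∀ c ∈ (addRims l k m nu).cells, c.2 < k) ∧
      (addRims l k m nu).colLen 0 ≤ (addRims l k m nu).colLen (k - 1) + l := by
  induction m with
  | zero =>
    refine ⟨fun c hc => ?_, ?_⟩
    · have := h hc
      simp only [Finset.mem_product, Finset.mem_range] at this
      exact this.2
    · by_contra hlt
      have h1 : (l, 0) ∈ nu.cells := by
        rw [YoungDiagram.mem_cells, YoungDiagram.mem_iff_lt_colLen]
        simp only [addRims, Function.iterate_zero, id_eq] at hlt
        omega
      have := h h1
      simp at this
  | succ m ih =>
    have hs : addRims l k (m + 1) nu = addFullRim l k (addRims l k m nu) :=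
      Function.iterate_succ_apply' _ _ _
    refine ⟨?_, ?_⟩
    · rintro ⟨i, j⟩ hc
      rw [hs, YoungDiagram.mem_cells, mem_addFullRim] at hc
      exact hc.1
    · rw [hs, colLen_addFullRim hk ih.2, colLen_addFullRim hk ih.2]
      have := (addRims l k m nu).colLen_anti (k - 1 - 1) (k - 1) (by omega)
      split_ifs <;> omega

/-- `ν[0] = ν`, and `ν[m+1]` is the one and only diagram obtained from `ν[m]` by adding a rim
`n`-hook from the first to the `k`-th column. -/
theorem addsFullRim_addRims_iff {l k : ℕ} (hk : 0 < k) {nu rho : YoungDiagram}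
    (h : InBox l k nu) (m : ℕ) :
    AddsFullRim l k (addRims l k m nu) rho ↔ rho = addRims l k (m + 1) nu := by
  rw [addsFullRim_iff hk (addRims_bounds hk h m).1 (addRims_bounds hk h m).2]
  rw [show addRims l k (m + 1) nu = addFullRim l k (addRims l k m nu) from
    Function.iterate_succ_apply' _ _ _]

end RimFacts

end QuantumKostka

/-! Let `M` be a `k × k` matrix and let row vectors `w a` satisfy `w (a + 1) = w a * M` and `w (a +
n) = c • w a`, where `n = l + k`. Attach to a diagram λ the determinant [λ] whose rows are `w (λ'_j
+ k - 1 - j)` for `0 ≤ j < k`, with λ' the column lengths. If W is this matrix of rows, expanding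
`det W * det (1 + tM) = det (W + tWM)` row by row writes `e_p(M) [λ]` as the sum over all ways to
lengthen p columns by one box. If the result is not a diagram, two rows are equal; if its first
column exceeds its k-th by more than l, the first row is c times the last. Both kinds of terms
vanish. What survives are the cylindric diagrams τ for which τ/λ is a horizontal strip of p boxes
(`sum_stripSuccs_rowDet`).

A semistandard tableau is a chain of horizontal strips, and for cylindric λ properness says exactly
that every shape in the chain is cylindric. Iteration therefore counts proper tableaux
(`prod_elemCoeff_mul_rowDet`). Every cylindric diagram is ν[m] for exactly one pair (ν, m) with ν in
the box, and each rim hook rotates the rows and scales one of them by c, so `[ν[m]] = ((-1)^(k-1)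
c)^m [ν]`.

In Λ(l,k) let f be the generating series of the σ_i and define h by `f(t) h(-t) = 1`. The
coefficients of h are the Y_p. The defining relations say that windows of k consecutive coefficients
of h satisfy the periodicity with `c = (-1)^(k-1) q`; M is the companion matrix of the recurrence,
and `e_p(M) = σ_p` for `p ≤ k`. The dual Jacobi–Trudi identity `det_rowLen_eq_det_colLen` identifies
[λ] with σ_λ.

Reading off independence of the order of μ in Λ(l,k) would require linear independence of the σ_ν.
Instead the same expansion is used in the group ring of `(ℤ/n)^k`, with `w a = (x_1^a, …, x_k^a)`
and `c = 1`. There the [ν] are alternants separated by their coefficients, and each Kostka number is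
a signed coefficient of a product symmetric in μ. -/

namespace QuantumKostka

/-! ### Toeplitz matrices of power series and complementary minors -/

section Toeplitz

variable {R : Type*} [CommRing R]

/-- The coefficients of a power series, extended by zero to negative indices. -/
noncomputable def zCoeff (f : PowerSeries R) (i : ℤ) : R :=
  if 0 ≤ i then PowerSeries.coeff i.toNat f else 0

theorem zCoeff_natCast (f : PowerSeries R) (i : ℕ) : zCoeff f i = PowerSeries.coeff i f := by
  simp [zCoeff]

theorem zCoeff_of_neg (f : PowerSeries R) {i : ℤ} (h : i < 0) : zCoeff f i = 0 := by
  simp [zCoeff, not_le.2 h]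

/-- The upper triangular Toeplitz matrix of a power series. -/
noncomputable def toeplitz (N : ℕ) (f : PowerSeries R) : Matrix (Fin N) (Fin N) R :=
  Matrix.of fun i j => zCoeff f ((j : ℤ) - (i : ℤ))

theorem toeplitz_mul (N : ℕ) (f g : PowerSeries R) :
    toeplitz N f * toeplitz N g = toeplitz N (f * g) := by
  ext i k
  simp only [Matrix.mul_apply, toeplitz, Matrix.of_apply]
  rw [Fin.sum_univ_eq_sum_range
    (fun j : ℕ => zCoeff f ((j : ℤ) - (i : ℤ)) * zCoeff g ((k : ℤ) - (j : ℤ))) N]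
  by_cases hik : (i : ℕ) ≤ k
  · obtain ⟨d, hd⟩ := Nat.exists_eq_add_of_le hik
    rw [show ((k : ℕ) : ℤ) - (i : ℕ) = (d : ℕ) by omega, zCoeff_natCast, PowerSeries.coeff_mul,
      Finset.Nat.sum_antidiagonal_eq_sum_range_succ_mk]
    symm
    apply Finset.sum_of_injOn (fun m => (i : ℕ) + m)
    · intro a _ b _ h
      simpa using h
    · intro a ha
      simp only [Finset.coe_range, Set.mem_Iio] at ha ⊢
      omega
    · intro j _ hj
      by_cases h1 : j < (i : ℕ)
      · rw [zCoeff_of_neg f (by omega), zero_mul]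
      · rw [zCoeff_of_neg g, mul_zero]
        by_contra h2
        exact hj ⟨j - i, by simp only [Finset.coe_range, Set.mem_Iio]; omega, by
          simp only; omega⟩
    · intro m hm
      rw [Finset.mem_range] at hm
      rw [← zCoeff_natCast, ← zCoeff_natCast]
      congr 2 <;> omega
  · rw [zCoeff_of_neg _ (by omega)]
    apply Finset.sum_eq_zero
    intro j _
    by_cases h1 : j < (i : ℕ)
    · rw [zCoeff_of_neg f (by omega), zero_mul]
    · rw [zCoeff_of_neg g (by omega), mul_zero]

theorem toeplitz_one (N : ℕ) : toeplitz N (1 : PowerSeries R) = 1 := by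
  ext i j
  simp only [toeplitz, Matrix.of_apply, zCoeff, PowerSeries.coeff_one, Matrix.one_apply,
    Fin.ext_iff]
  split_ifs <;> first | rfl | omega

theorem det_toeplitz (N : ℕ) {f : PowerSeries R} (h : PowerSeries.coeff 0 f = 1) :
    (toeplitz N f).det = 1 := by
  rw [Matrix.det_of_isUpperTriangular]
  · apply Finset.prod_eq_one
    intro i _
    simp [toeplitz, zCoeff, h]
  · intro i j hij
    have : (j : ℕ) < i := hij
    simp only [toeplitz, Matrix.of_apply]
    exact zCoeff_of_neg _ (by omega)

/-- Jacobi's identity for complementary minors, for matrices in block form. -/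
theorem det_toBlocks₁₁_of_mul_eq_one {m n : Type*} [Fintype m] [Fintype n] [DecidableEq m]
    [DecidableEq n] {A B : Matrix (m ⊕ n) (m ⊕ n) R} (h : A * B = 1) :
    A.toBlocks₁₁.det = A.det * B.toBlocks₂₂.det := by
  rw [← Matrix.fromBlocks_toBlocks A, ← Matrix.fromBlocks_toBlocks B, Matrix.fromBlocks_multiply,
    ← Matrix.fromBlocks_one, Matrix.fromBlocks_inj] at h
  obtain ⟨-, h12, -, h22⟩ := h
  -- The right factor has the first block column of the identity and the second of `B`, so the
  -- product has the first block column of `A` and the second of the identity.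
  have key : A * Matrix.fromBlocks 1 B.toBlocks₁₂ 0 B.toBlocks₂₂ =
      Matrix.fromBlocks A.toBlocks₁₁ 0 A.toBlocks₂₁ 1 := by
    conv_lhs => rw [← Matrix.fromBlocks_toBlocks A]
    rw [Matrix.fromBlocks_multiply, h12, h22]
    simp
  have := congrArg Matrix.det key
  rw [Matrix.det_mul, Matrix.det_fromBlocks_zero₂₁, Matrix.det_fromBlocks_zero₁₂] at this
  simpa using this.symm

end Toeplitz

/-! ### The boundary path of a diagram as a permutation -/

section BoundaryPath

theorem rowLen_eq_of_mem_iff {a : YoungDiagram} {i N : ℕ} (h : ∀ j, (i, j) ∈ a ↔ j < N) :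
    a.rowLen i = N := by
  have h' : ∀ j, j < a.rowLen i ↔ j < N := fun j => by
    rw [← YoungDiagram.mem_iff_lt_rowLen, h j]
  have h1 := h' N
  have h2 := h' (a.rowLen i)
  omega

/-- A nonempty diagram has a corner box. -/
theorem exists_corner {lam : YoungDiagram} (h : lam.card ≠ 0) :
    ∃ i j, lam.rowLen i = j + 1 ∧ lam.colLen j = i + 1 := by
  have h0 : (0, 0) ∈ lam := by
    obtain ⟨⟨i, j⟩, hc⟩ := Finset.card_pos.1 (Nat.pos_of_ne_zero h)
    exact lam.up_left_mem (Nat.zero_le i) (Nat.zero_le j) hc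
  have h1 : 0 < lam.rowLen 0 := YoungDiagram.mem_iff_lt_rowLen.1 h0
  have h2 : (0, lam.rowLen 0 - 1) ∈ lam := YoungDiagram.mem_iff_lt_rowLen.2 (by omega)
  have h3 := YoungDiagram.mem_iff_lt_colLen.1 h2
  refine ⟨lam.colLen (lam.rowLen 0 - 1) - 1, lam.rowLen 0 - 1, ?_, by omega⟩
  have h4 : (lam.colLen (lam.rowLen 0 - 1) - 1, lam.rowLen 0 - 1) ∈ lam :=
    YoungDiagram.mem_iff_lt_colLen.2 (by omega)
  have h5 := YoungDiagram.mem_iff_lt_rowLen.1 h4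
  have h6 := lam.rowLen_anti 0 (lam.colLen (lam.rowLen 0 - 1) - 1) (Nat.zero_le _)
  omega

/-- The diagram with a corner box removed. -/
def eraseCorner (lam : YoungDiagram) (i j : ℕ) (hr : lam.rowLen i = j + 1)
    (hc : lam.colLen j = i + 1) : YoungDiagram where
  cells := lam.cells.erase (i, j)
  isLowerSet := by
    rintro ⟨a, b⟩ ⟨a', b'⟩ hle h
    obtain ⟨h1, h2⟩ := Prod.mk_le_mk.1 hle
    simp only [Finset.coe_erase, Set.mem_sdiff, Finset.mem_coe, Set.mem_singleton_iff,
      Prod.mk.injEq, YoungDiagram.mem_cells] at h ⊢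
    refine ⟨lam.up_left_mem h1 h2 h.1, ?_⟩
    rintro ⟨rfl, rfl⟩
    have h3 := YoungDiagram.mem_iff_lt_rowLen.1 (lam.up_left_mem h1 le_rfl h.1)
    have h4 := YoungDiagram.mem_iff_lt_colLen.1 (lam.up_left_mem le_rfl h2 h.1)
    omega

/-- The steps of the boundary path of a diagram in an `r × c` rectangle are numbered by a permutation
of the rows and columns whose sign is the parity of the number of boxes. -/
theorem exists_boundary_perm (r c : ℕ) (lam : YoungDiagram) (hr : lam.colLen 0 ≤ r)
    (hc : lam.rowLen 0 ≤ c) :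
    ∃ g : Equiv.Perm (Fin (r + c)), Equiv.Perm.sign g = (-1) ^ lam.card ∧
      (∀ i : Fin (r + c), (i : ℕ) < r →
        (g i : ℕ) = lam.rowLen (r - 1 - i) + i) ∧
      (∀ j : Fin (r + c), r ≤ (j : ℕ) → (g j : ℕ) + lam.colLen (j - r) = j) := by
  induction hn : lam.card using Nat.strong_induction_on generalizing lam with
  | _ N ih =>
  subst hn
  by_cases h0 : lam.card = 0
  · have hbot : ∀ x, x ∉ lam := by
      intro x hx
      have : 0 < lam.card := Finset.card_pos.2 ⟨x, hx⟩
      omega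
    refine ⟨1, by simp [h0], ?_, ?_⟩
    · intro i _
      rw [rowLen_eq_of_mem_iff (N := 0) (fun j => by simp [hbot])]
      simp
    · intro j _
      rw [colLen_eq_of_mem_iff (N := 0) (fun j => by simp [hbot])]
      simp
  · obtain ⟨i, j, hi, hj⟩ := exists_corner h0
    have hir : i < r := by have := lam.colLen_anti 0 j (Nat.zero_le _); omega
    have hjc : j < c := by have := lam.rowLen_anti 0 i (Nat.zero_le _); omega
    have hmem : (i, j) ∈ lam.cells := YoungDiagram.mem_iff_lt_rowLen.2 (by omega)
    set mu := eraseCorner lam i j hi hj with hmu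
    have hmem' : ∀ a b, (a, b) ∈ mu ↔ (a, b) ∈ lam ∧ ¬ (a = i ∧ b = j) := by
      intro a b
      rw [← YoungDiagram.mem_cells]
      simp only [hmu, eraseCorner, Finset.mem_erase, ne_eq, Prod.mk.injEq, YoungDiagram.mem_cells]
      tauto
    have hrow : ∀ a, mu.rowLen a = if a = i then j else lam.rowLen a := by
      intro a
      apply rowLen_eq_of_mem_iff
      intro b
      rw [hmem', YoungDiagram.mem_iff_lt_rowLen]
      split_ifs with h
      · subst h; omega
      · simp [h]
    have hcol : ∀ b, mu.colLen b = if b = j then i else lam.colLen b := by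
      intro b
      apply colLen_eq_of_mem_iff
      intro a
      rw [hmem', YoungDiagram.mem_iff_lt_colLen]
      split_ifs with h
      · subst h; omega
      · simp [h]
    have hcard : mu.card + 1 = lam.card := Finset.card_erase_add_one hmem
    obtain ⟨g, hg1, hg2, hg3⟩ := ih mu.card (by omega) mu
      (by rw [hcol]; split_ifs <;> omega) (by rw [hrow]; split_ifs <;> omega) rfl
    have ha : r - 1 - i < r + c := by omega
    have hb : r + j < r + c := by omega
    have hne : (⟨r - 1 - i, ha⟩ : Fin (r + c)) ≠ ⟨r + j, hb⟩ := by
      simp only [ne_eq, Fin.mk.injEq]; omega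
    have hga : (g ⟨r - 1 - i, ha⟩ : ℕ) = j + (r - 1 - i) := by
      rw [hg2 _ (by simp only; omega), hrow]
      simp only
      rw [if_pos (by omega)]
    have hgb : (g ⟨r + j, hb⟩ : ℕ) = j + (r - i) := by
      have := hg3 ⟨r + j, hb⟩ (by simp)
      rw [hcol] at this
      simp only [Nat.add_sub_cancel_left, if_true] at this
      omega
    -- Restoring the corner exchanges the consecutive path positions `j + (r - 1 - i)` and `j + (r -
    -- i)` of its row step and its column step.
    refine ⟨g * Equiv.swap ⟨r - 1 - i, ha⟩ ⟨r + j, hb⟩, ?_, ?_, ?_⟩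
    · rw [Equiv.Perm.sign_mul, Equiv.Perm.sign_swap hne, hg1, ← hcard, pow_succ]
    · intro a har
      rw [Equiv.Perm.mul_apply]
      by_cases h1 : a = ⟨r - 1 - i, ha⟩
      · subst h1
        rw [Equiv.swap_apply_left, hgb]
        simp only
        rw [show r - 1 - (r - 1 - i) = i by omega, hi]
        omega
      · have h2 : (a : ℕ) ≠ r - 1 - i := fun h => h1 (Fin.ext h)
        rw [Equiv.swap_apply_of_ne_of_ne h1 (fun h => by rw [h] at har; simp at har), hg2 a har,
          hrow, if_neg (by omega)]
    · intro b hbr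
      rw [Equiv.Perm.mul_apply]
      by_cases h1 : b = ⟨r + j, hb⟩
      · subst h1
        rw [Equiv.swap_apply_right, hga]
        simp only [Nat.add_sub_cancel_left]
        omega
      · have h2 : (b : ℕ) ≠ r + j := fun h => h1 (Fin.ext h)
        have h3 := hg3 b hbr
        rw [hcol, if_neg (by omega)] at h3
        rw [Equiv.swap_apply_of_ne_of_ne (fun h => by rw [h] at hbr; simp at hbr; omega) h1, h3]

end BoundaryPath

/-! ### The dual Jacobi–Trudi identity -/

section JacobiTrudi

variable {R : Type*} [CommRing R]

theorem zCoeff_evalNegHom (h : PowerSeries R) (a b : ℕ) :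
    zCoeff (PowerSeries.evalNegHom h) ((b : ℤ) - a) =
      (-1) ^ a * ((-1) ^ b * zCoeff h ((b : ℤ) - a)) := by
  by_cases hab : a ≤ b
  · obtain ⟨d, rfl⟩ := Nat.exists_eq_add_of_le hab
    rw [show ((a + d : ℕ) : ℤ) - a = (d : ℕ) by omega, zCoeff_natCast, zCoeff_natCast,
      PowerSeries.evalNegHom, PowerSeries.coeff_rescale, ← mul_assoc, ← pow_add]
    congr 1
    rw [show a + (a + d) = 2 * a + d by ring, pow_add, pow_mul]
    simp
  · rw [zCoeff_of_neg _ (by omega), zCoeff_of_neg _ (by omega)]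
    simp

/-- The two Jacobi–Trudi determinants of a diagram in an `r × c` rectangle agree. -/
theorem det_rowLen_eq_det_colLen {f h : PowerSeries R} (hf : PowerSeries.coeff 0 f = 1)
    (hfh : f * PowerSeries.evalNegHom h = 1) (r c : ℕ) (lam : YoungDiagram)
    (hr : lam.colLen 0 ≤ r) (hc : lam.rowLen 0 ≤ c) :
    Matrix.det (Matrix.of fun i j : Fin r => zCoeff f ((lam.rowLen i : ℤ) + j - i)) =
      Matrix.det (Matrix.of fun i j : Fin c => zCoeff h ((lam.colLen i : ℤ) + j - i)) := by
  obtain ⟨g, hg1, hg2, hg3⟩ := exists_boundary_perm r c lam hr hc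
  have hwidth : ∀ x ∈ lam.cells, x.2 < c := by
    rintro ⟨a, b⟩ hx
    have h1 := YoungDiagram.mem_iff_lt_rowLen.1 ((YoungDiagram.mem_cells _).1 hx)
    have h2 := lam.rowLen_anti 0 a (Nat.zero_le _)
    simp only; omega
  let e : Fin r ⊕ Fin c ≃ Fin (r + c) := finSumFinEquiv
  -- Ordering the columns by the boundary path makes both Jacobi–Trudi matrices, up to signs and
  -- reindexing, complementary blocks of the inverse matrices `A` and `B`.
  set A : Matrix (Fin r ⊕ Fin c) (Fin r ⊕ Fin c) R :=
    (toeplitz (r + c) f).submatrix e (e.trans g) with hA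
  set B : Matrix (Fin r ⊕ Fin c) (Fin r ⊕ Fin c) R :=
    (toeplitz (r + c) (PowerSeries.evalNegHom h)).submatrix (e.trans g) e with hB
  have hAB : A * B = 1 := by
    rw [hA, hB, Matrix.submatrix_mul_equiv, toeplitz_mul, hfh, toeplitz_one,
      Matrix.submatrix_one_equiv]
  have hdA : A.det = (-1) ^ lam.card := by
    have : A = ((toeplitz (r + c) f).submatrix id g).submatrix e e := by
      ext i j; rfl
    rw [this, Matrix.det_submatrix_equiv_self, Matrix.det_permute', det_toeplitz _ hf, hg1]
    simp
  have key := det_toBlocks₁₁_of_mul_eq_one hAB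
  have h11 : A.toBlocks₁₁.det =
      Matrix.det (Matrix.of fun i j : Fin r => zCoeff f ((lam.rowLen i : ℤ) + j - i)) := by
    -- The path meets the rows of the diagram from the bottom up, hence the reversal.
    rw [← Matrix.det_submatrix_equiv_self Fin.revPerm, ← Matrix.det_transpose]
    congr 1
    ext i j
    simp only [Matrix.transpose_apply, Matrix.submatrix_apply, Matrix.toBlocks₁₁, Matrix.of_apply,
      hA, toeplitz, Equiv.trans_apply, Fin.revPerm_apply, e]
    have h1 := hg2 (finSumFinEquiv (Sum.inl (Fin.rev i))) (by
      have := i.2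
      simp only [finSumFinEquiv_apply_left, Fin.val_castAdd, Fin.val_rev]; omega)
    rw [h1]
    simp only [finSumFinEquiv_apply_left, Fin.val_castAdd, Fin.val_rev]
    rw [show r - 1 - (r - (↑i + 1)) = (i : ℕ) by omega]
    congr 1
    push_cast
    have := i.2
    have := j.2
    omega
  have h22 : B.toBlocks₂₂.det = (-1) ^ lam.card *
      Matrix.det (Matrix.of fun i j : Fin c => zCoeff h ((lam.colLen i : ℤ) + j - i)) := by
    have hval : ∀ i : Fin c, (g (e (Sum.inr i)) : ℕ) + lam.colLen i = r + i := by
      intro i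
      have := hg3 (e (Sum.inr i)) (by simp [e])
      simpa [e] using this
    have h1 : B.toBlocks₂₂ = Matrix.of fun i j : Fin c => (-1) ^ (g (e (Sum.inr i)) : ℕ) *
        (Matrix.of fun i j : Fin c => (-1) ^ (r + (j : ℕ)) *
          (Matrix.of fun i j : Fin c => zCoeff h ((lam.colLen i : ℤ) + j - i)) i j) i j := by
      ext i j
      simp only [Matrix.toBlocks₂₂, hB, Matrix.of_apply, Matrix.submatrix_apply, toeplitz,
        Equiv.trans_apply]
      rw [zCoeff_evalNegHom]
      have h2 : (e (Sum.inr j) : ℕ) = r + j := by simp [e]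
      have h3 := hval i
      rw [h2]
      congr 3
      push_cast
      omega
    -- For each `i` the row sign and the column sign multiply to `(-1) ^ lam.colLen i`; together
    -- they give the parity of the number of boxes, which cancels `A.det`.
    rw [h1, Matrix.det_mul_column, Matrix.det_mul_row, ← mul_assoc, ← Finset.prod_mul_distrib]
    congr 1
    rw [card_eq_sum_colLen lam c hwidth, ← Fin.sum_univ_eq_sum_range, ← Finset.prod_pow_eq_pow_sum]
    refine Finset.prod_congr rfl fun i _ => ?_
    rw [← hval i, ← pow_add, ← add_assoc, pow_add, ← two_mul, pow_mul]
    simp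
  rw [← h11, key, hdA, h22, ← mul_assoc, ← mul_pow]
  simp

end JacobiTrudi

/-! ### Cylindric diagrams and horizontal strips -/

section Cylindric

/-- A diagram with at most `k` columns whose periodic continuation by steps of `l` rows and `k`
columns is again bounded by a lattice path. -/
def IsCylindric (l k : ℕ) (rho : YoungDiagram) : Prop :=
  (∀ c ∈ rho.cells, c.2 < k) ∧ rho.colLen 0 ≤ rho.colLen (k - 1) + l

theorem IsCylindric.colLen_eq_zero {l k : ℕ} {rho : YoungDiagram} (h : IsCylindric l k rho) {j : ℕ}
    (hj : k ≤ j) : rho.colLen j = 0 := by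
  by_contra h0
  have h1 : (0, j) ∈ rho.cells := YoungDiagram.mem_iff_lt_colLen.2 (Nat.pos_of_ne_zero h0)
  have := h.1 _ h1
  simp only at this
  omega

theorem IsCylindric.card_eq {l k : ℕ} {rho : YoungDiagram} (h : IsCylindric l k rho) :
    rho.card = ∑ j : Fin k, rho.colLen j := by
  rw [card_eq_sum_colLen rho k h.1, ← Fin.sum_univ_eq_sum_range]

theorem InBox.isCylindric {l k : ℕ} (hk : 0 < k) {lam : YoungDiagram} (h : InBox l k lam) :
    IsCylindric l k lam :=
  addRims_bounds hk h 0

/-- The diagram with given weakly decreasing column lengths, cut off after `k` columns. -/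
def ofColLens (k : ℕ) (c : ℕ → ℕ) (hc : ∀ i j, i ≤ j → j < k → c j ≤ c i) : YoungDiagram where
  cells := (Finset.range (c 0) ×ˢ Finset.range k).filter fun x => x.1 < c x.2
  isLowerSet := by
    rintro ⟨a, b⟩ ⟨a', b'⟩ hle h
    obtain ⟨h1, h2⟩ := Prod.mk_le_mk.1 hle
    simp only [Finset.coe_filter, Finset.mem_product, Finset.mem_range, Set.mem_ofPred_eq] at h ⊢
    have := hc b' b h2 h.1.2
    omega

theorem colLen_ofColLens {k : ℕ} {c : ℕ → ℕ} (hc : ∀ i j, i ≤ j → j < k → c j ≤ c i) (j : ℕ) :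
    (ofColLens k c hc).colLen j = if j < k then c j else 0 := by
  apply colLen_eq_of_mem_iff
  intro i
  rw [← YoungDiagram.mem_cells]
  simp only [ofColLens, Finset.mem_filter, Finset.mem_product, Finset.mem_range]
  have := hc 0 j (Nat.zero_le _)
  split_ifs <;> omega

theorem width_ofColLens {k : ℕ} {c : ℕ → ℕ} (hc : ∀ i j, i ≤ j → j < k → c j ≤ c i) :
    ∀ x ∈ (ofColLens k c hc).cells, x.2 < k := by
  rintro ⟨a, b⟩ h
  simp only [ofColLens, Finset.mem_filter, Finset.mem_product, Finset.mem_range] at h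
  exact h.1.2

/-- The finite set of cylindric diagrams with `N` boxes. -/
noncomputable def cylindricShapes (l k N : ℕ) : Finset YoungDiagram :=
  open Classical in (boxShapes N k).filter fun rho => IsCylindric l k rho ∧ rho.card = N

theorem mem_cylindricShapes {l k N : ℕ} {rho : YoungDiagram} :
    rho ∈ cylindricShapes l k N ↔ IsCylindric l k rho ∧ rho.card = N := by
  simp only [cylindricShapes, Finset.mem_filter, mem_boxShapes, and_iff_right_iff_imp]
  rintro ⟨h1, h2⟩ ⟨i, j⟩ hx
  simp only [Finset.mem_product, Finset.mem_range]
  refine ⟨?_, h1.1 _ hx⟩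
  have h3 := YoungDiagram.mem_iff_lt_colLen.1 ((YoungDiagram.mem_cells _).1 hx)
  have h4 : rho.colLen j ≤ rho.card := by
    rw [YoungDiagram.colLen_eq_card]
    exact Finset.card_le_card (Finset.filter_subset _ _)
  omega

/-- The cylindric diagrams obtained from `λ` by adding a horizontal strip with `p` boxes. -/
noncomputable def stripSuccs (l k p : ℕ) (lam : YoungDiagram) : Finset YoungDiagram :=
  open Classical in (cylindricShapes l k (lam.card + p)).filter fun tau =>
    ∀ j, lam.colLen j ≤ tau.colLen j ∧ tau.colLen j ≤ lam.colLen j + 1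

theorem mem_stripSuccs {l k p : ℕ} {lam tau : YoungDiagram} :
    tau ∈ stripSuccs l k p lam ↔ IsCylindric l k tau ∧ tau.card = lam.card + p ∧
      ∀ j, lam.colLen j ≤ tau.colLen j ∧ tau.colLen j ≤ lam.colLen j + 1 := by
  simp only [stripSuccs, Finset.mem_filter, mem_cylindricShapes, and_assoc]

end Cylindric

/-! ### The Pieri rule for row determinants -/

section Pieri

variable {R : Type*} [CommRing R] {k : ℕ}

/-- The determinant whose rows are the vectors `w (a j)`. -/
noncomputable def rowDet (w : ℕ → Fin k → R) (a : Fin k → ℕ) : R :=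
  Matrix.det (Matrix.of fun j => w (a j))

/-- The coefficients of the polynomial `det (1 + t M)`. -/
noncomputable def elemCoeff (M : Matrix (Fin k) (Fin k) R) (p : ℕ) : R :=
  (Matrix.det (1 + (Polynomial.X : Polynomial R) • M.map Polynomial.C)).coeff p

/-- Row `j` of `W * (1 + X M)` is `w (a j) + X w (a j + 1)`. Multilinearity in the rows turns its
determinant into a sum over the set `S` of rows where the second summand is chosen; the coefficient
of `X ^ p` selects `S.card = p`. -/
theorem sum_rowDet_add_indicator {w : ℕ → Fin k → R} {M : Matrix (Fin k) (Fin k) R}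
    (hw : ∀ a, w (a + 1) = Matrix.vecMul (w a) M) (a : Fin k → ℕ) (p : ℕ) :
    ∑ S ∈ Finset.powersetCard p (Finset.univ : Finset (Fin k)),
      rowDet w (fun j => a j + if j ∈ S then 1 else 0) = elemCoeff M p * rowDet w a := by
  set W : Matrix (Fin k) (Fin k) R := Matrix.of fun j => w (a j) with hW
  have h1 : W.map Polynomial.C * (1 + (Polynomial.X : Polynomial R) • M.map Polynomial.C) =
      Matrix.of ((fun j => (Polynomial.X : Polynomial R) • fun i => Polynomial.C (w (a j + 1) i)) +
        fun j i => Polynomial.C (w (a j) i)) := by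
    rw [mul_add, mul_one, Matrix.mul_smul, ← Matrix.map_mul, add_comm]
    ext1 j i
    simp only [Matrix.add_apply, Matrix.smul_apply, Matrix.map_apply, Matrix.of_apply, hW,
      Pi.add_apply, Pi.smul_apply, hw]
    rfl
  have h2 := congrArg (fun A => (Matrix.det A).coeff p) h1
  simp only [Matrix.det_mul] at h2
  have hC : (W.map Polynomial.C).det = Polynomial.C W.det :=
    (RingHom.map_det (Polynomial.C) W).symm
  rw [hC, Polynomial.coeff_C_mul] at h2
  rw [rowDet, elemCoeff, mul_comm, h2]
  have h3 : ∀ S : Finset (Fin k),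
      Matrix.detRowAlternating (S.piecewise
        (fun j => (Polynomial.X : Polynomial R) • fun i => Polynomial.C (w (a j + 1) i))
        (fun j i => Polynomial.C (w (a j) i))) =
      Polynomial.X ^ S.card *
        Polynomial.C (rowDet w (fun j => a j + if j ∈ S then 1 else 0)) := by
    intro S
    -- Both branches are written with one family of rows, so that the scalars `X` can be pulled out
    -- of the rows in `S`.
    have e : S.piecewise
        (fun j => (Polynomial.X : Polynomial R) • fun i => Polynomial.C (w (a j + 1) i))
        (fun j i => Polynomial.C (w (a j) i)) =
        S.piecewise (fun j => (Polynomial.X : Polynomial R) •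
          (fun i => Polynomial.C (w (a j + if j ∈ S then 1 else 0) i)))
        (fun j i => Polynomial.C (w (a j + if j ∈ S then 1 else 0) i)) := by
      ext1 j
      by_cases hj : j ∈ S <;> simp [hj]
    rw [e, ← AlternatingMap.coe_multilinearMap, MultilinearMap.map_piecewise_smul
      _ (fun _ => (Polynomial.X : Polynomial R)), Finset.prod_const, smul_eq_mul, rowDet,
      RingHom.map_det]
    rfl
  have h4 : Matrix.det (Matrix.of
      ((fun j => (Polynomial.X : Polynomial R) • fun i => Polynomial.C (w (a j + 1) i)) +
        fun j i => Polynomial.C (w (a j) i))) = ∑ S : Finset (Fin k), Polynomial.X ^ S.card *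
        Polynomial.C (rowDet w (fun j => a j + if j ∈ S then 1 else 0)) := by
    rw [← Finset.sum_congr rfl fun S _ => h3 S]
    exact MultilinearMap.map_add_univ (Matrix.detRowAlternating.toMultilinearMap) _ _
  rw [h4, Polynomial.finsetSum_coeff, Finset.powersetCard_eq_filter, Finset.powerset_univ,
    Finset.sum_filter]
  refine Finset.sum_congr rfl fun S _ => ?_
  rw [mul_comm, Polynomial.coeff_C_mul, Polynomial.coeff_X_pow]
  simp [eq_comm]

theorem rowDet_eq_zero {w : ℕ → Fin k → R} {a : Fin k → ℕ} {i j : Fin k} (hij : i ≠ j) {c : R}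
    (h : w (a i) = c • w (a j)) : rowDet w a = 0 := by
  have h1 : (Matrix.of fun j => w (a j)) =
      Matrix.updateRow (Matrix.of fun j => w (a j)) i (c • w (a j)) := by
    conv_lhs => rw [← Matrix.updateRow_eq_self (Matrix.of fun j => w (a j)) i]
    congr 1
  rw [rowDet, h1, Matrix.det_updateRow_smul]
  have h2 : w (a j) = (Matrix.of fun j => w (a j)) j := rfl
  rw [h2, Matrix.det_updateRow_eq_zero hij.symm, mul_zero]

/-- The strictly decreasing sequence `λ'_j + (k - j)` attached to the column lengths of `λ`. -/
def colVec (k : ℕ) (lam : YoungDiagram) : Fin k → ℕ := fun j => lam.colLen j + (k - 1 - j)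

/-- A strip is encoded by the set of columns it lengthens. A set of columns that yields no cylindric
diagram contributes a determinant with two proportional rows. -/
theorem sum_stripSuccs_rowDet {l : ℕ} {w : ℕ → Fin k → R} {M : Matrix (Fin k) (Fin k) R} {c : R}
    (hw : ∀ a, w (a + 1) = Matrix.vecMul (w a) M) (hn : ∀ a, w (a + (l + k)) = c • w a)
    {lam : YoungDiagram} (hlam : IsCylindric l k lam) (p : ℕ) :
    ∑ tau ∈ stripSuccs l k p lam, rowDet w (colVec k tau) =
      elemCoeff M p * rowDet w (colVec k lam) := by
  rw [← sum_rowDet_add_indicator hw]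
  have hval : ∀ tau ∈ stripSuccs l k p lam, ∀ j : Fin k, tau.colLen j =
      lam.colLen j + if j ∈ Finset.univ.filter
        (fun j : Fin k => tau.colLen j = lam.colLen j + 1) then 1 else 0 := by
    intro tau ht j
    have := (mem_stripSuccs.1 ht).2.2 j
    simp only [Finset.mem_filter, Finset.mem_univ, true_and]
    split_ifs <;> omega
  apply Finset.sum_of_injOn
    (fun tau => Finset.univ.filter fun j : Fin k => tau.colLen j = lam.colLen j + 1)
  · intro t1 h1 t2 h2 h12
    simp only at h12
    apply ext_colLen
    intro j
    by_cases hj : j < k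
    · have e1 := hval t1 h1 ⟨j, hj⟩
      have e2 := hval t2 h2 ⟨j, hj⟩
      rw [h12] at e1
      exact e1.trans e2.symm
    · rw [(mem_stripSuccs.1 h1).1.colLen_eq_zero (not_lt.1 hj),
        (mem_stripSuccs.1 h2).1.colLen_eq_zero (not_lt.1 hj)]
  · intro tau ht
    have h1 := Finset.sum_congr rfl fun j (_ : j ∈ Finset.univ) => hval tau ht j
    have h2 := mem_stripSuccs.1 ht
    rw [← h2.1.card_eq, Finset.sum_add_distrib, ← hlam.card_eq, Finset.sum_boole,
      Finset.filter_mem_eq_inter, Finset.univ_inter, h2.2.1] at h1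
    simp only [true_and, Finset.mem_coe, Finset.mem_powersetCard, Finset.subset_univ]
    simpa using h1.symm
  · intro S hS hS'
    by_contra hne
    have hcard := (Finset.mem_powersetCard.1 hS).2
    set d : ℕ → ℕ := fun j => if h : j < k then lam.colLen j + (if (⟨j, h⟩ : Fin k) ∈ S then 1 else 0)
      else 0 with hd
    have hd' : ∀ j : Fin k, d j = lam.colLen j + if j ∈ S then 1 else 0 := by
      intro j
      simp [hd]
    have hstep : ∀ j, j + 1 < k → d (j + 1) ≤ d j := by
      intro j hj
      by_contra hlt
      have h1 := lam.colLen_anti j (j + 1) (by omega)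
      have e1 := hd' ⟨j, by omega⟩
      have e2 := hd' ⟨j + 1, hj⟩
      simp only at e1 e2
      -- Here columns `j` and `j + 1` of `lam` have equal length and only the second grows, so rows
      -- `j` and `j + 1` carry the same index.
      apply hne
      refine rowDet_eq_zero (i := ⟨j, by omega⟩) (j := ⟨j + 1, hj⟩) (c := 1) ?_ ?_
      · simp
      · rw [one_smul]
        congr 1
        simp only [colVec]
        have : (if (⟨j, by omega⟩ : Fin k) ∈ S then 1 else 0) ≤ 1 := by split_ifs <;> omega
        have : (if (⟨j + 1, hj⟩ : Fin k) ∈ S then 1 else 0) ≤ 1 := by split_ifs <;> omega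
        omega
    have hanti : ∀ i j, i ≤ j → j < k → d j ≤ d i := by
      intro i j hij hj
      induction j, hij using Nat.le_induction with
      | base => exact le_rfl
      | succ m hm ih => exact (hstep m hj).trans (ih (by omega))
    have hcl : ∀ j, (ofColLens k d hanti).colLen j = d j := by
      intro j
      rw [colLen_ofColLens]
      split_ifs with h
      · rfl
      · simp [hd, h]
    have hcyl : IsCylindric l k (ofColLens k d hanti) := by
      refine ⟨width_ofColLens hanti, ?_⟩
      rw [hcl, hcl]
      by_cases hk : 0 < k
      swap
      · simp [hd, hk]
      by_contra hlt
      have h1 := hlam.2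
      have e1 := hd' ⟨0, hk⟩
      have e2 := hd' ⟨k - 1, by omega⟩
      simp only at e1 e2
      have h3 : (if (⟨0, by omega⟩ : Fin k) ∈ S then 1 else 0) ≤ 1 := by split_ifs <;> omega
      have hk1 : 0 ≠ k - 1 := by
        intro h
        rw [← h] at hlt
        omega
      -- Here `d 0 = d (k - 1) + l + 1`, so the index of the first row exceeds that of the last by
      -- exactly `l + k`.
      apply hne
      refine rowDet_eq_zero (i := ⟨0, by omega⟩) (j := ⟨k - 1, by omega⟩) (c := c) ?_ ?_
      · simpa using hk1
      · rw [← hn]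
        congr 1
        simp only [colVec]
        omega
    apply hS'
    refine ⟨ofColLens k d hanti, ?_, ?_⟩
    · rw [Finset.mem_coe, mem_stripSuccs]
      refine ⟨hcyl, ?_, ?_⟩
      · rw [hcyl.card_eq, hlam.card_eq, ← hcard]
        simp_rw [hcl, hd', Finset.sum_add_distrib]
        simp
      · intro j
        rw [hcl]
        by_cases hj : j < k
        · have e1 := hd' ⟨j, hj⟩
          simp only at e1
          split_ifs at e1 <;> omega
        · rw [hlam.colLen_eq_zero (not_lt.1 hj)]
          simp [hd, hj]
    · ext j
      simp [hcl, hd']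
  · intro tau ht
    congr 1
    ext j
    have := hval tau ht j
    simp only [colVec]
    omega

end Pieri

/-! ### Proper tableaux as chains of cylindric diagrams -/

section TableauRecursion

/-- A proper semistandard tableau on `ρ/λ` of content `μ`. -/
def IsProperTableau (l k : ℕ) {lam rho : YoungDiagram} {r : ℕ} (mu : Fin r → ℕ)
    (T : ↥(rho.cells \ lam.cells) → Fin r) : Prop :=
  lam ≤ rho ∧ IsSemistandard T ∧ HasContent T mu ∧ IsProper l k T

/-- The number of proper semistandard tableaux on `ρ/λ` of content `μ`. -/
noncomputable def tableauCount (l k : ℕ) {r : ℕ} (lam : YoungDiagram) (mu : Fin r → ℕ)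
    (rho : YoungDiagram) : ℕ :=
  Nat.card {T : ↥(rho.cells \ lam.cells) → Fin r // IsProperTableau l k mu T}

theorem quantumKostka_eq_tableauCount (l k : ℕ) {r : ℕ} (lam : YoungDiagram) (mu : Fin r → ℕ)
    (nu : YoungDiagram) (m : ℕ) :
    quantumKostka l k lam mu nu m = tableauCount l k lam mu (addRims l k m nu) :=
  rfl

theorem colLen_mono {a b : YoungDiagram} (h : a ≤ b) (j : ℕ) : a.colLen j ≤ b.colLen j := by
  by_contra hlt
  have h1 : (b.colLen j, j) ∈ a := YoungDiagram.mem_iff_lt_colLen.2 (by omega)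
  have h2 := YoungDiagram.mem_iff_lt_colLen.1 (h h1)
  omega

theorem le_of_colLen_le {a b : YoungDiagram} (h : ∀ j, a.colLen j ≤ b.colLen j) : a ≤ b := by
  rintro ⟨i, j⟩ hx
  have h1 := YoungDiagram.mem_iff_lt_colLen.1 hx
  exact YoungDiagram.mem_iff_lt_colLen.2 (h1.trans_le (h j))

theorem mem_skew {lam rho : YoungDiagram} {x : ℕ × ℕ} (h1 : x ∈ rho) (h2 : x ∉ lam) :
    x ∈ rho.cells \ lam.cells :=
  Finset.mem_sdiff.2 ⟨h1, h2⟩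

theorem mem_of_skew {lam rho : YoungDiagram} (c : ↥(rho.cells \ lam.cells)) : c.1 ∈ rho :=
  (Finset.mem_sdiff.1 c.2).1

theorem notMem_of_skew {lam rho : YoungDiagram} (c : ↥(rho.cells \ lam.cells)) : c.1 ∉ lam :=
  (Finset.mem_sdiff.1 c.2).2

/-! ### Splitting off the smallest letter: `T` is `0` on τ/λ and is `T'` shifted by one on ρ/τ -/

section Extension

variable {l k r : ℕ} {lam tau rho : YoungDiagram} {mu : Fin (r + 1) → ℕ}
  {T : ↥(rho.cells \ lam.cells) → Fin (r + 1)} {T' : ↥(rho.cells \ tau.cells) → Fin r}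

theorem hasContent_iff_of_extension (hlt : lam ≤ tau) (htr : tau ≤ rho)
    (h0 : ∀ c, c.1 ∈ tau → T c = 0)
    (h1 : ∀ (c : ↥(rho.cells \ lam.cells)) (h : c.1 ∉ tau),
      T c = (T' ⟨c.1, mem_skew (mem_of_skew c) h⟩).succ) :
    HasContent T mu ↔ tau.card = lam.card + mu 0 ∧ HasContent T' fun i => mu i.succ := by
  have e0 : (Finset.univ.filter fun c => T c = 0).card + lam.card = tau.card := by
    have : (Finset.univ.filter fun c => T c = 0).card = (tau.cells \ lam.cells).card := by
      apply Finset.card_bij (fun c _ => c.1)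
      · intro c hc
        refine mem_skew ?_ (notMem_of_skew c)
        by_contra h
        simp [h1 c h] at hc
      · intro a _ b _ h
        exact Subtype.ext h
      · intro x hx
        obtain ⟨hx1, hx2⟩ := Finset.mem_sdiff.1 hx
        exact ⟨⟨x, mem_skew (htr hx1) hx2⟩, by simpa using h0 _ hx1, rfl⟩
    rw [this]
    exact Finset.card_sdiff_add_card_eq_card hlt
  have e1 : ∀ i : Fin r, (Finset.univ.filter fun c => T c = i.succ).card =
      (Finset.univ.filter fun c => T' c = i).card := by
    intro i
    symm
    apply Finset.card_bij
      (fun c _ => ⟨c.1, mem_skew (mem_of_skew c) fun h => notMem_of_skew c (hlt h)⟩)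
    · intro c hc
      simp only [Finset.mem_filter, Finset.mem_univ, true_and] at hc ⊢
      rw [h1 _ (notMem_of_skew c), hc]
    · intro a _ b _ h
      exact Subtype.ext (congrArg (fun x => x.1) h)
    · intro c hc
      simp only [Finset.mem_filter, Finset.mem_univ, true_and] at hc
      have hct : c.1 ∉ tau := fun h => by
        rw [h0 c h] at hc
        exact (Fin.succ_ne_zero i) hc.symm
      refine ⟨⟨c.1, mem_skew (mem_of_skew c) hct⟩, ?_, rfl⟩
      rw [h1 c hct] at hc
      simpa using hc
  unfold HasContent
  rw [Fin.forall_fin_succ]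
  simp_rw [e1]
  refine and_congr_left fun _ => ?_
  omega

theorem isSemistandard_of_extension
    (h0 : ∀ c, c.1 ∈ tau → T c = 0)
    (h1 : ∀ (c : ↥(rho.cells \ lam.cells)) (h : c.1 ∉ tau),
      T c = (T' ⟨c.1, mem_skew (mem_of_skew c) h⟩).succ)
    (hs : ∀ j, tau.colLen j ≤ lam.colLen j + 1) (hT' : IsSemistandard T') :
    IsSemistandard T := by
  constructor
  · rintro ⟨⟨i, j⟩, hc⟩ ⟨⟨i', j'⟩, hd⟩ h2 h3
    simp only at h2 h3
    subst h2
    by_cases h4 : (i, j) ∈ tau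
    · rw [h0 _ h4]
      exact Fin.zero_le _
    · have h5 : (i, j') ∉ tau := fun h => h4 (tau.up_left_mem le_rfl h3.le h)
      rw [h1 _ h4, h1 _ h5, Fin.succ_le_succ_iff]
      exact hT'.1 _ _ rfl h3
  · rintro ⟨⟨i, j⟩, hc⟩ ⟨⟨i', j'⟩, hd⟩ h2 h3
    simp only at h2 h3
    subst h2
    have h6 : lam.colLen j ≤ i := by
      by_contra h
      exact notMem_of_skew ⟨_, hc⟩ (YoungDiagram.mem_iff_lt_colLen.2 (not_le.1 h))
    have h5 : (i', j) ∉ tau := fun h => by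
      have := YoungDiagram.mem_iff_lt_colLen.1 h
      have := hs j
      omega
    by_cases h4 : (i, j) ∈ tau
    · rw [h0 _ h4, h1 _ h5]
      exact Fin.succ_pos _
    · rw [h1 _ h4, h1 _ h5, Fin.succ_lt_succ_iff]
      exact hT'.2 _ _ rfl h3

theorem isSemistandard_restrict (hlt : lam ≤ tau)
    (h1 : ∀ (c : ↥(rho.cells \ lam.cells)) (h : c.1 ∉ tau),
      T c = (T' ⟨c.1, mem_skew (mem_of_skew c) h⟩).succ)
    (hT : IsSemistandard T) : IsSemistandard T' := by
  have key : ∀ c : ↥(rho.cells \ tau.cells), ∃ d : ↥(rho.cells \ lam.cells), d.1 = c.1 ∧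
      T d = (T' c).succ := fun c =>
    ⟨⟨c.1, mem_skew (mem_of_skew c) fun h => notMem_of_skew c (hlt h)⟩, rfl,
      h1 _ (notMem_of_skew c)⟩
  constructor
  · intro c d h2 h3
    obtain ⟨c', hc, hc'⟩ := key c
    obtain ⟨d', hd, hd'⟩ := key d
    rw [← Fin.succ_le_succ_iff, ← hc', ← hd']
    exact hT.1 _ _ (by rw [hc, hd, h2]) (by rw [hc, hd]; exact h3)
  · intro c d h2 h3
    obtain ⟨c', hc, hc'⟩ := key c
    obtain ⟨d', hd, hd'⟩ := key d
    rw [← Fin.succ_lt_succ_iff, ← hc', ← hd']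
    exact hT.2 _ _ (by rw [hc, hd, h2]) (by rw [hc, hd]; exact h3)

theorem colLen_le_succ_of_extension (htr : tau ≤ rho)
    (h0 : ∀ c, c.1 ∈ tau → T c = 0) (hT : IsSemistandard T) (j : ℕ) :
    tau.colLen j ≤ lam.colLen j + 1 := by
  by_contra hlt
  have h1 : (lam.colLen j, j) ∈ tau := YoungDiagram.mem_iff_lt_colLen.2 (by omega)
  have h2 : (lam.colLen j + 1, j) ∈ tau := YoungDiagram.mem_iff_lt_colLen.2 (by omega)
  have h3 : (lam.colLen j, j) ∉ lam := fun h => by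
    have := YoungDiagram.mem_iff_lt_colLen.1 h
    omega
  have h4 : (lam.colLen j + 1, j) ∉ lam := fun h => by
    have := YoungDiagram.mem_iff_lt_colLen.1 h
    omega
  have := hT.2 ⟨_, mem_skew (htr h1) h3⟩ ⟨_, mem_skew (htr h2) h4⟩ rfl (Nat.lt_succ_self _)
  rw [h0 _ h1, h0 _ h2] at this
  exact lt_irrefl _ this

/-- For a first-column box with entry `0`, cylindricity of `tau` puts its partner in the k-th column
inside `tau`, where the entry, if any, is also `0`. The remaining boxes are governed by `T'`. -/
theorem isProper_of_extension (hlt : lam ≤ tau) (htr : tau ≤ rho)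
    (h0 : ∀ c, c.1 ∈ tau → T c = 0)
    (h1 : ∀ (c : ↥(rho.cells \ lam.cells)) (h : c.1 ∉ tau),
      T c = (T' ⟨c.1, mem_skew (mem_of_skew c) h⟩).succ)
    (ht : tau.colLen 0 ≤ tau.colLen (k - 1) + l) (hT' : IsProper l k T') : IsProper l k T := by
  intro c p hcp
  have key : (p, k - 1) ∈ tau →
      (p, k - 1) ∈ lam ∨ ∃ d : ↥(rho.cells \ lam.cells), d.1 = (p, k - 1) ∧ T d ≤ T c := by
    intro h
    by_cases h2 : (p, k - 1) ∈ lam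
    · exact Or.inl h2
    · refine Or.inr ⟨⟨_, mem_skew (htr h) h2⟩, rfl, ?_⟩
      rw [h0 _ h]
      exact Fin.zero_le _
  by_cases hc : c.1 ∈ tau
  · apply key
    rw [hcp] at hc
    have := YoungDiagram.mem_iff_lt_colLen.1 hc
    exact YoungDiagram.mem_iff_lt_colLen.2 (by omega)
  · rcases hT' ⟨c.1, mem_skew (mem_of_skew c) hc⟩ p hcp with h2 | ⟨d, hd, hd'⟩
    · exact key h2
    · refine Or.inr ⟨⟨d.1, mem_skew (mem_of_skew d) fun h => notMem_of_skew d (hlt h)⟩, hd, ?_⟩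
      rw [h1 c hc, h1 _ (notMem_of_skew d), Fin.succ_le_succ_iff]
      exact hd'

theorem isProper_restrict (hlt : lam ≤ tau)
    (h1 : ∀ (c : ↥(rho.cells \ lam.cells)) (h : c.1 ∉ tau),
      T c = (T' ⟨c.1, mem_skew (mem_of_skew c) h⟩).succ)
    (hT : IsProper l k T) : IsProper l k T' := by
  intro c p hcp
  rcases hT ⟨c.1, mem_skew (mem_of_skew c) fun h => notMem_of_skew c (hlt h)⟩ p hcp with
    h2 | ⟨d, hd, hd'⟩
  · exact Or.inl (hlt h2)
  · by_cases h3 : d.1 ∈ tau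
    · exact Or.inl (hd ▸ h3)
    · refine Or.inr ⟨⟨d.1, mem_skew (mem_of_skew d) h3⟩, hd, ?_⟩
      rw [h1 d h3, h1 _ (notMem_of_skew c), Fin.succ_le_succ_iff] at hd'
      exact hd'

/-- If `tau` failed the bound, the box in row `l + tau.colLen (k - 1)` of the first column would
have entry `0`, while its partner lies just below the k-th column of `tau` and could only have a
positive entry. -/
theorem colLen_zero_le_of_extension (htr : tau ≤ rho)
    (h0 : ∀ c, c.1 ∈ tau → T c = 0) (hlt : lam ≤ tau)
    (h1 : ∀ (c : ↥(rho.cells \ lam.cells)) (h : c.1 ∉ tau),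
      T c = (T' ⟨c.1, mem_skew (mem_of_skew c) h⟩).succ)
    (hlam : lam.colLen 0 ≤ lam.colLen (k - 1) + l) (hT : IsProper l k T) :
    tau.colLen 0 ≤ tau.colLen (k - 1) + l := by
  by_contra hgt
  have h2 : (l + (tau.colLen (k - 1)), 0) ∈ tau := YoungDiagram.mem_iff_lt_colLen.2 (by omega)
  have h3 : (tau.colLen (k - 1), k - 1) ∉ tau := fun h => by
    have := YoungDiagram.mem_iff_lt_colLen.1 h
    omega
  have h4 : (l + (tau.colLen (k - 1)), 0) ∉ lam := fun h => by
    have := YoungDiagram.mem_iff_lt_colLen.1 h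
    have := colLen_mono hlt (k - 1)
    omega
  rcases hT ⟨_, mem_skew (htr h2) h4⟩ _ rfl with h5 | ⟨d, hd, hd'⟩
  · exact h3 (hlt h5)
  · rw [h0 ⟨_, mem_skew (htr h2) h4⟩ h2, h1 d (hd ▸ h3)] at hd'
    exact absurd (Fin.succ_pos _) (not_lt.2 hd')

theorem isProperTableau_iff_of_extension (hlam : IsCylindric l k lam)
    (hrho : ∀ x ∈ rho.cells, x.2 < k) (hlt : lam ≤ tau) (htr : tau ≤ rho)
    (h0 : ∀ c, c.1 ∈ tau → T c = 0)
    (h1 : ∀ (c : ↥(rho.cells \ lam.cells)) (h : c.1 ∉ tau),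
      T c = (T' ⟨c.1, mem_skew (mem_of_skew c) h⟩).succ) :
    IsProperTableau l k mu T ↔
      tau ∈ stripSuccs l k (mu 0) lam ∧ IsProperTableau l k (fun i => mu i.succ) T' := by
  rw [mem_stripSuccs]
  constructor
  · rintro ⟨-, hS, hC, hP⟩
    obtain ⟨hC1, hC2⟩ := (hasContent_iff_of_extension hlt htr h0 h1).1 hC
    exact ⟨⟨⟨fun x hx => hrho x (htr hx), colLen_zero_le_of_extension htr h0 hlt h1 hlam.2 hP⟩,
      hC1, fun j => ⟨colLen_mono hlt j, colLen_le_succ_of_extension htr h0 hS j⟩⟩,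
      htr, isSemistandard_restrict hlt h1 hS, hC2, isProper_restrict hlt h1 hP⟩
  · rintro ⟨⟨hcyl, hcard, hstrip⟩, -, hS, hC, hP⟩
    exact ⟨hlt.trans htr, isSemistandard_of_extension h0 h1 (fun j => (hstrip j).2) hS,
      (hasContent_iff_of_extension hlt htr h0 h1).2 ⟨hcard, hC⟩,
      isProper_of_extension hlt htr h0 h1 hcyl.2 hP⟩

end Extension

/-- The diagram formed by `λ` and the boxes of `ρ/λ` with the smallest entry. -/
def firstShape {lam rho : YoungDiagram} {r : ℕ}
    (T : ↥(rho.cells \ lam.cells) → Fin (r + 1)) (hT : IsSemistandard T) : YoungDiagram where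
  cells := lam.cells ∪ (Finset.univ.filter fun c => T c = 0).map (Function.Embedding.subtype _)
  isLowerSet := by
    have hmem : ∀ x, x ∈ ((lam.cells ∪ (Finset.univ.filter fun c => T c = 0).map
        (Function.Embedding.subtype _) : Finset (ℕ × ℕ)) : Set (ℕ × ℕ)) ↔
        x ∈ lam ∨ ∃ h : x ∈ rho.cells \ lam.cells, T ⟨x, h⟩ = 0 := by
      intro x
      simp
    rintro ⟨a, b⟩ ⟨a', b'⟩ hle' h
    obtain ⟨h1, h2⟩ := Prod.mk_le_mk.1 hle'
    rw [hmem] at h ⊢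
    by_cases hl : (a', b') ∈ lam
    · exact Or.inl hl
    rcases h with h | ⟨h, h0⟩
    · exact absurd (lam.up_left_mem h1 h2 h) hl
    · have hr : (a, b) ∈ rho := (Finset.mem_sdiff.1 h).1
      -- The corner of the path that goes up column `b` and then left along row `a'`; entries do not
      -- increase along it.
      have hm : (a', b) ∈ rho.cells \ lam.cells :=
        mem_skew (rho.up_left_mem h1 le_rfl hr) fun h' => hl (lam.up_left_mem le_rfl h2 h')
      have hf : (a', b') ∈ rho.cells \ lam.cells := mem_skew (rho.up_left_mem h1 h2 hr) hl
      have e1 : T ⟨_, hm⟩ ≤ T ⟨_, h⟩ := by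
        rcases h1.eq_or_lt with h1 | h1
        · subst h1; exact le_rfl
        · exact (hT.2 ⟨_, hm⟩ ⟨_, h⟩ rfl h1).le
      have e2 : T ⟨_, hf⟩ ≤ T ⟨_, hm⟩ := by
        rcases h2.eq_or_lt with h2 | h2
        · subst h2; exact le_rfl
        · exact hT.1 ⟨_, hf⟩ ⟨_, hm⟩ rfl h2
      refine Or.inr ⟨hf, ?_⟩
      rw [h0] at e1
      exact Fin.le_zero_iff.1 (e2.trans e1)

theorem mem_firstShape {lam rho : YoungDiagram} {r : ℕ}
    {T : ↥(rho.cells \ lam.cells) → Fin (r + 1)} (hT : IsSemistandard T) {x : ℕ × ℕ} :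
    x ∈ firstShape T hT ↔ x ∈ lam ∨ ∃ h : x ∈ rho.cells \ lam.cells, T ⟨x, h⟩ = 0 := by
  rw [← YoungDiagram.mem_cells]
  simp [firstShape]

/-- Extension of a filling of `ρ/τ` to `ρ/λ` by a new smallest letter. -/
noncomputable def extendFilling {lam tau rho : YoungDiagram} {r : ℕ}
    (T' : ↥(rho.cells \ tau.cells) → Fin r) (c : ↥(rho.cells \ lam.cells)) : Fin (r + 1) :=
  open Classical in
  if h : c.1 ∈ tau then 0 else (T' ⟨c.1, mem_skew (mem_of_skew c) h⟩).succ

theorem extendFilling_of_mem {lam tau rho : YoungDiagram} {r : ℕ}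
    (T' : ↥(rho.cells \ tau.cells) → Fin r) (c : ↥(rho.cells \ lam.cells)) (h : c.1 ∈ tau) :
    extendFilling T' c = 0 := by
  simp [extendFilling, h]

theorem extendFilling_of_notMem {lam tau rho : YoungDiagram} {r : ℕ}
    (T' : ↥(rho.cells \ tau.cells) → Fin r) (c : ↥(rho.cells \ lam.cells)) (h : c.1 ∉ tau) :
    extendFilling T' c = (T' ⟨c.1, mem_skew (mem_of_skew c) h⟩).succ := by
  simp [extendFilling, h]

/-- Removing the smallest letter from a proper tableau. -/
theorem tableauCount_succ {l k r : ℕ} {lam rho : YoungDiagram}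
    (hlam : IsCylindric l k lam) (hrho : ∀ x ∈ rho.cells, x.2 < k) (mu : Fin (r + 1) → ℕ) :
    tableauCount l k lam mu rho =
      ∑ tau ∈ stripSuccs l k (mu 0) lam, tableauCount l k tau (fun i => mu i.succ) rho := by
  have hlt : ∀ tau ∈ stripSuccs l k (mu 0) lam, lam ≤ tau := fun tau ht =>
    le_of_colLen_le fun j => ((mem_stripSuccs.1 ht).2.2 j).1
  let G : (Σ tau : ↥(stripSuccs l k (mu 0) lam), {T' : ↥(rho.cells \ tau.1.cells) → Fin r //
      IsProperTableau l k (fun i => mu i.succ) T'}) →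
      {T : ↥(rho.cells \ lam.cells) → Fin (r + 1) // IsProperTableau l k mu T} := fun x =>
    ⟨extendFilling x.2.1, (isProperTableau_iff_of_extension hlam hrho (hlt _ x.1.2) x.2.2.1
      (extendFilling_of_mem _) (extendFilling_of_notMem _)).2 ⟨x.1.2, x.2.2⟩⟩
  have hG : Function.Bijective G := by
    constructor
    · rintro ⟨⟨t1, ht1⟩, ⟨T1, hT1⟩⟩ ⟨⟨t2, ht2⟩, ⟨T2, hT2⟩⟩ h
      have h' : ∀ c : ↥(rho.cells \ lam.cells),
          extendFilling T1 c = extendFilling T2 c := fun c =>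
        congrFun (congrArg Subtype.val h) c
      -- The extended filling determines the intermediate shape: outside `lam`, it consists of the
      -- boxes with entry `0`.
      have key : ∀ {s1 s2 : YoungDiagram} {S1 : ↥(rho.cells \ s1.cells) → Fin r}
          {S2 : ↥(rho.cells \ s2.cells) → Fin r}, lam ≤ s2 → s1 ≤ rho →
          (∀ c : ↥(rho.cells \ lam.cells), extendFilling S1 c = extendFilling S2 c) →
          s1 ≤ s2 := by
        intro s1 s2 S1 S2 h1 h2 h3 x hx
        by_contra hx2
        have h4 := h3 ⟨x, mem_skew (h2 hx) fun h => hx2 (h1 h)⟩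
        rw [extendFilling_of_mem _ _ hx, extendFilling_of_notMem _ _ hx2] at h4
        exact Fin.succ_ne_zero _ h4.symm
      have ht : t1 = t2 := le_antisymm (key (hlt _ ht2) hT1.1 h')
        (key (hlt _ ht1) hT2.1 fun c => (h' c).symm)
      subst ht
      have hT : T1 = T2 := by
        funext c
        have hc := h' ⟨c.1, mem_skew (mem_of_skew c) fun h => notMem_of_skew c (hlt _ ht1 h)⟩
        have hc1 := extendFilling_of_notMem (lam := lam) T1
          ⟨c.1, mem_skew (mem_of_skew c) fun h => notMem_of_skew c (hlt _ ht1 h)⟩ (notMem_of_skew c)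
        have hc2 := extendFilling_of_notMem (lam := lam) T2
          ⟨c.1, mem_skew (mem_of_skew c) fun h => notMem_of_skew c (hlt _ ht1 h)⟩ (notMem_of_skew c)
        exact Fin.succ_injective _ (hc1.symm.trans (hc.trans hc2))
      subst hT
      rfl
    · rintro ⟨T, hT⟩
      have hmem := fun x => mem_firstShape (x := x) hT.2.1
      set tau := firstShape T hT.2.1 with htau
      have h1 : ∀ (c : ↥(rho.cells \ lam.cells)), c.1 ∉ tau → T c ≠ 0 := fun c hc h0 =>
        hc ((hmem _).2 (Or.inr ⟨c.2, h0⟩))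
      have hltau : lam ≤ tau := fun x hx => (hmem _).2 (Or.inl hx)
      have htr : tau ≤ rho := fun x hx => ((hmem _).1 hx).elim (fun h => hT.1 h)
        fun h => (Finset.mem_sdiff.1 h.1).1
      let T' : ↥(rho.cells \ tau.cells) → Fin r := fun c =>
        (T ⟨c.1, mem_skew (mem_of_skew c) fun h => notMem_of_skew c (hltau h)⟩).pred
          (h1 _ (notMem_of_skew c))
      have e0 : ∀ c : ↥(rho.cells \ lam.cells), c.1 ∈ tau → T c = 0 := fun c hc =>
        ((hmem _).1 hc).elim (fun h => absurd h (notMem_of_skew c)) fun h => h.2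
      have e1 : ∀ (c : ↥(rho.cells \ lam.cells)) (h : c.1 ∉ tau),
          T c = (T' ⟨c.1, mem_skew (mem_of_skew c) h⟩).succ := fun c h =>
        (Fin.succ_pred _ _).symm
      obtain ⟨h2, h3⟩ := (isProperTableau_iff_of_extension hlam hrho hltau htr e0 e1).1 hT
      refine ⟨⟨⟨tau, h2⟩, ⟨T', h3⟩⟩, Subtype.ext (funext fun c => ?_)⟩
      by_cases hc : c.1 ∈ tau
      · exact (extendFilling_of_mem T' c hc).trans (e0 c hc).symm
      · exact (extendFilling_of_notMem T' c hc).trans (e1 c hc).symm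
  rw [tableauCount, ← Nat.card_congr (Equiv.ofBijective G hG), Nat.card_sigma]
  exact Finset.sum_coe_sort (stripSuccs l k (mu 0) lam)
    fun tau => tableauCount l k tau (fun i => mu i.succ) rho

theorem tableauCount_zero (l k : ℕ) (lam : YoungDiagram) (mu : Fin 0 → ℕ) (rho : YoungDiagram) :
    tableauCount l k lam mu rho = open Classical in if rho = lam then 1 else 0 := by
  rw [tableauCount]
  split_ifs with h
  · subst h
    have hempty : ∀ c : ↥(rho.cells \ rho.cells), False := fun c => by
      have := c.2
      simp at this
    rw [Nat.card_eq_one_iff_unique]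
    refine ⟨⟨fun a b => Subtype.ext (funext fun c => (hempty c).elim)⟩,
      ⟨⟨fun c => (hempty c).elim, le_rfl, ⟨fun c => (hempty c).elim, fun c => (hempty c).elim⟩,
        fun i => i.elim0, fun c => (hempty c).elim⟩⟩⟩
  · rw [Nat.card_eq_zero]
    refine Or.inl ⟨fun T => h ?_⟩
    refine le_antisymm (fun x hx => ?_) T.2.1
    by_contra hx'
    exact (T.1 ⟨x, mem_skew hx hx'⟩).elim0

end TableauRecursion

/-! ### Iterating the Pieri rule -/

section IteratedPieri

variable {R : Type*} [CommRing R] {k : ℕ}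

theorem prod_elemCoeff_mul_rowDet {l : ℕ} {w : ℕ → Fin k → R}
    {M : Matrix (Fin k) (Fin k) R} {c : R}
    (hw : ∀ a, w (a + 1) = Matrix.vecMul (w a) M) (hn : ∀ a, w (a + (l + k)) = c • w a)
    {r : ℕ} (mu : Fin r → ℕ) {lam : YoungDiagram} (hlam : IsCylindric l k lam) :
    (∏ i, elemCoeff M (mu i)) * rowDet w (colVec k lam) =
      ∑ rho ∈ cylindricShapes l k (lam.card + ∑ i, mu i),
        (tableauCount l k lam mu rho : R) * rowDet w (colVec k rho) := by
  induction r generalizing lam with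
  | zero =>
    simp_rw [tableauCount_zero]
    classical
    rw [Finset.sum_eq_single lam]
    · simp
    · intro b _ hb
      simp [hb]
    · intro h
      exact absurd (mem_cylindricShapes.2 ⟨hlam, by simp⟩) h
  | succ r ih =>
    rw [Fin.prod_univ_succ, mul_comm (elemCoeff M (mu 0)), mul_assoc,
      ← sum_stripSuccs_rowDet hw hn hlam, Finset.mul_sum]
    have h1 : ∀ rho ∈ cylindricShapes l k (lam.card + ∑ i, mu i),
        (tableauCount l k lam mu rho : R) * rowDet w (colVec k rho) =
        ∑ tau ∈ stripSuccs l k (mu 0) lam,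
          (tableauCount l k tau (fun i => mu i.succ) rho : R) * rowDet w (colVec k rho) := by
      intro rho hrho
      rw [tableauCount_succ hlam (mem_cylindricShapes.1 hrho).1.1 mu, Nat.cast_sum,
        Finset.sum_mul]
    rw [Finset.sum_congr rfl h1, Finset.sum_comm]
    refine Finset.sum_congr rfl fun tau ht => ?_
    have h2 := mem_stripSuccs.1 ht
    rw [ih (fun i => mu i.succ) h2.1, h2.2.1, Fin.sum_univ_succ, add_assoc]

end IteratedPieri

/-! ### Cylindric diagrams as box shapes with rim hooks added -/

section RimBijection

variable {l k : ℕ}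

theorem addRims_succ (l k m : ℕ) (nu : YoungDiagram) :
    addRims l k (m + 1) nu = addFullRim l k (addRims l k m nu) :=
  Function.iterate_succ_apply' _ _ _

theorem InBox.isCylindric_addRims (hk : 0 < k) {nu : YoungDiagram} (h : InBox l k nu) (m : ℕ) :
    IsCylindric l k (addRims l k m nu) :=
  addRims_bounds hk h m

theorem card_addFullRim (hk : 0 < k) {nu : YoungDiagram} (h : IsCylindric l k nu)
    (h' : IsCylindric l k (addFullRim l k nu)) :
    (addFullRim l k nu).card = nu.card + (l + k) := by
  rw [h'.card_eq, h.card_eq]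
  obtain ⟨k, rfl⟩ : ∃ k', k = k' + 1 := ⟨k - 1, by omega⟩
  rw [Fin.sum_univ_succ, Fin.sum_univ_castSucc]
  simp only [colLen_addFullRim hk h.2, Fin.val_zero, if_true, Fin.val_succ, Nat.succ_ne_zero,
    if_false, Nat.add_sub_cancel, Fin.val_castSucc, Fin.val_last]
  rw [Finset.sum_congr rfl fun (j : Fin k) _ => if_pos (Nat.succ_lt_succ j.2),
    Finset.sum_add_distrib]
  simp
  omega

theorem InBox.card_addRims (hk : 0 < k) {nu : YoungDiagram} (h : InBox l k nu) (m : ℕ) :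
    (addRims l k m nu).card = nu.card + m * (l + k) := by
  induction m with
  | zero => simp [addRims]
  | succ m ih =>
    have h1 := h.isCylindric_addRims hk (m + 1)
    rw [addRims_succ] at h1 ⊢
    rw [card_addFullRim hk (h.isCylindric_addRims hk m) h1, ih]
    ring

theorem addFullRim_injOn (hk : 0 < k) {a b : YoungDiagram} (ha : IsCylindric l k a)
    (hb : IsCylindric l k b) (h : addFullRim l k a = addFullRim l k b) : a = b := by
  have h1 : ∀ j, (addFullRim l k a).colLen j = (addFullRim l k b).colLen j := fun j => by rw [h]
  simp only [colLen_addFullRim hk ha.2, colLen_addFullRim hk hb.2] at h1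
  apply ext_colLen
  intro j
  by_cases hj : k ≤ j
  · rw [ha.colLen_eq_zero hj, hb.colLen_eq_zero hj]
  · by_cases hj' : j = k - 1
    · subst hj'
      have := h1 0
      simp only [if_true] at this
      omega
    · have := h1 (j + 1)
      rw [if_neg (by omega), if_pos (by omega), if_neg (by omega), if_pos (by omega)] at this
      simpa using this

theorem not_inBox_addFullRim (hk : 0 < k) {a : YoungDiagram} (ha : IsCylindric l k a) :
    ¬ InBox l k (addFullRim l k a) := by
  intro h
  have h1 : (l, 0) ∈ addFullRim l k a := by
    rw [YoungDiagram.mem_iff_lt_colLen, colLen_addFullRim hk ha.2, if_pos rfl]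
    omega
  have := h ((YoungDiagram.mem_cells _).2 h1)
  simp at this

/-- Adding a full rim is injective and always leaves the box, so hooks can be stripped from both
sides until one shape, hence both, lies in the box. -/
theorem addRims_injOn (hk : 0 < k) {a b : YoungDiagram} (ha : InBox l k a) (hb : InBox l k b)
    {m m' : ℕ} (h : addRims l k m a = addRims l k m' b) : a = b ∧ m = m' := by
  induction m generalizing m' with
  | zero =>
    cases m' with
    | zero => exact ⟨h, rfl⟩
    | succ m' =>
      rw [addRims_succ] at h
      exact absurd (h ▸ ha) (not_inBox_addFullRim hk (hb.isCylindric_addRims hk m'))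
  | succ m ih =>
    rw [addRims_succ] at h
    cases m' with
    | zero => exact absurd (h ▸ hb) (not_inBox_addFullRim hk (ha.isCylindric_addRims hk m))
    | succ m' =>
      rw [addRims_succ] at h
      obtain ⟨h1, h2⟩ := ih (addFullRim_injOn hk (ha.isCylindric_addRims hk m)
        (hb.isCylindric_addRims hk m') h)
      exact ⟨h1, by rw [h2]⟩

theorem IsCylindric.inBox_or_exists_addFullRim (hk : 0 < k) {rho : YoungDiagram}
    (h : IsCylindric l k rho) :
    InBox l k rho ∨ ∃ nu, IsCylindric l k nu ∧ rho = addFullRim l k nu := by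
  by_cases hl : rho.colLen 0 ≤ l
  · left
    rintro ⟨i, j⟩ hx
    have h1 := YoungDiagram.mem_iff_lt_colLen.1 ((YoungDiagram.mem_cells _).1 hx)
    have h2 := rho.colLen_anti 0 j (Nat.zero_le _)
    simp only [Finset.mem_product, Finset.mem_range]
    exact ⟨by omega, h.1 _ hx⟩
  · right
    have hlast := h.2
    -- This inverts `colLen_addFullRim`. No subtraction truncates for `j < k`: the first column is
    -- longer than `l`, so by cylindricity the k-th column, and every earlier one, is nonempty.
    set d : ℕ → ℕ := fun j =>
      if j + 1 < k then rho.colLen (j + 1) - 1 else rho.colLen 0 - l - 1 with hd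
    have hanti : ∀ i j, i ≤ j → j < k → d j ≤ d i := by
      intro i j hij hj
      have h1 := rho.colLen_anti (i + 1) (j + 1) (by omega)
      have h2 : i + 1 < k → rho.colLen (k - 1) ≤ rho.colLen (i + 1) := fun h =>
        rho.colLen_anti (i + 1) (k - 1) (by omega)
      simp only [hd]
      split_ifs <;> omega
    have hcl := fun j => colLen_ofColLens hanti j
    have hcyl : IsCylindric l k (ofColLens k d hanti) := by
      refine ⟨width_ofColLens hanti, ?_⟩
      have h1 := rho.colLen_anti 0 1 (by omega)
      rw [hcl, hcl, if_pos hk, if_pos (by omega)]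
      simp only [hd, zero_add]
      split_ifs <;> omega
    refine ⟨_, hcyl, ext_colLen fun j => ?_⟩
    rw [colLen_addFullRim hk hcyl.2, hcl, hcl]
    have h3 : j < k → rho.colLen (k - 1) ≤ rho.colLen j := fun h =>
        rho.colLen_anti j (k - 1) (by omega)
    have h4 : k ≤ j → rho.colLen j = 0 := h.colLen_eq_zero
    by_cases h0 : j = 0
    · subst h0
      simp only [hd, if_true]
      rw [if_pos (by omega), if_neg (by omega)]
      omega
    · rw [if_neg h0]
      simp only [hd]
      rw [show j - 1 + 1 = j by omega]
      split_ifs <;> omega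

theorem IsCylindric.exists_addRims (hk : 0 < k) {rho : YoungDiagram} (h : IsCylindric l k rho) :
    ∃ nu m, InBox l k nu ∧ rho = addRims l k m nu := by
  induction hn : rho.card using Nat.strong_induction_on generalizing rho with
  | _ N ih =>
  rcases h.inBox_or_exists_addFullRim hk with h1 | ⟨tau, ht, rfl⟩
  · exact ⟨rho, 0, h1, rfl⟩
  · have := card_addFullRim hk ht h
    obtain ⟨nu, m, h2, rfl⟩ := ih tau.card (by omega) ht rfl
    exact ⟨nu, m + 1, h2, (addRims_succ l k m nu).symm⟩

theorem sum_cylindricShapes {A : Type*} [AddCommMonoid A] (hk : 0 < k) (N : ℕ)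
    (F : YoungDiagram → A) :
    ∑ rho ∈ cylindricShapes l k N, F rho =
      ∑ nu ∈ boxShapes l k,
        ∑ m ∈ (Finset.range (N + 1)).filter (fun m => nu.card + m * (l + k) = N),
          F (addRims l k m nu) := by
  rw [Finset.sum_sigma']
  symm
  apply Finset.sum_nbij (fun x => addRims l k x.2 x.1)
  · rintro ⟨nu, m⟩ hx
    simp only [Finset.mem_sigma, mem_boxShapes, Finset.mem_filter] at hx
    rw [mem_cylindricShapes]
    exact ⟨hx.1.isCylindric_addRims hk m, (hx.1.card_addRims hk m).trans hx.2.2⟩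
  · rintro ⟨nu, m⟩ hx ⟨nu', m'⟩ hx' h
    simp only [Finset.mem_coe, Finset.mem_sigma, mem_boxShapes] at hx hx'
    obtain ⟨rfl, rfl⟩ := addRims_injOn hk hx.1 hx'.1 h
    rfl
  · intro rho hrho
    obtain ⟨h1, h2⟩ := mem_cylindricShapes.1 (Finset.mem_coe.1 hrho)
    obtain ⟨nu, m, h3, rfl⟩ := h1.exists_addRims hk
    rw [h3.card_addRims hk] at h2
    refine ⟨⟨nu, m⟩, ?_, rfl⟩
    simp only [Finset.mem_coe, Finset.mem_sigma, mem_boxShapes, Finset.mem_filter,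
      Finset.mem_range]
    -- This is why the range up to `N` contains every possible `m`.
    have : m ≤ m * (l + k) := Nat.le_mul_of_pos_right _ (by omega)
    exact ⟨h3, by omega, h2⟩
  · intro _ _
    rfl

end RimBijection

/-! ### The effect of rim hooks on row determinants -/

section RimReduction

variable {R : Type*} [CommRing R] {k l : ℕ}

/-- The row indices of the new diagram are those of `nu` rotated by one place, with the last index
raised by `l + k` and moved to the front. The k-cycle gives the sign and periodicity gives `c`. -/
theorem rowDet_addFullRim (hk : 0 < k) {w : ℕ → Fin k → R} {c : R}
    (hn : ∀ a, w (a + (l + k)) = c • w a) {nu : YoungDiagram} (h : IsCylindric l k nu) :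
    rowDet w (colVec k (addFullRim l k nu)) = (-1) ^ (k - 1) * c * rowDet w (colVec k nu) := by
  obtain ⟨k, rfl⟩ : ∃ k', k = k' + 1 := ⟨k - 1, by omega⟩
  set W' : Matrix (Fin (k + 1)) (Fin (k + 1)) R :=
    Matrix.of fun j => w (colVec (k + 1) (addFullRim l (k + 1) nu) j) with hW'
  set W : Matrix (Fin (k + 1)) (Fin (k + 1)) R := Matrix.of fun j => w (colVec (k + 1) nu j) with hW
  have h1 : W'.submatrix (finRotate (k + 1)) id = W.updateRow (Fin.last k) (c • W (Fin.last k)) := by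
    ext i x
    induction i using Fin.lastCases with
    | last =>
      rw [Matrix.updateRow_self]
      change w (colVec (k + 1) _ (finRotate (k + 1) (Fin.last k))) x = (c • w _) x
      rw [finRotate_last, ← hn]
      congr 1
      simp only [colVec, colLen_addFullRim hk h.2, Fin.val_zero, if_true, Fin.val_last]
      simp only [Nat.add_sub_cancel]
      omega
    | cast i =>
      rw [Matrix.updateRow_ne (Fin.castSucc_lt_last i).ne]
      change w (colVec (k + 1) _ (finRotate (k + 1) i.castSucc)) x = w _ x
      congr 1
      rw [finRotate_apply, Fin.coeSucc_eq_succ]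
      have := i.2
      simp only [colVec, colLen_addFullRim hk h.2, Fin.val_succ, Fin.val_castSucc]
      rw [if_neg (by omega), if_pos (by omega)]
      simp only [Nat.add_sub_cancel]
      omega
  have h2 := congrArg Matrix.det h1
  have h3 : W.updateRow (Fin.last k) (W (Fin.last k)) = W := Matrix.updateRow_eq_self W _
  rw [Matrix.det_permute, sign_finRotate, Matrix.det_updateRow_smul, h3] at h2
  have h4 : ((-1 : R) ^ k) * (-1) ^ k = 1 := by
    rw [← mul_pow]; simp
  change W'.det = _ * W.det
  rw [mul_assoc, ← h2]
  simp only [Nat.add_sub_cancel]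
  push_cast
  rw [← mul_assoc, h4, one_mul]

theorem rowDet_addRims (hk : 0 < k) {w : ℕ → Fin k → R} {c : R}
    (hn : ∀ a, w (a + (l + k)) = c • w a) {nu : YoungDiagram} (h : InBox l k nu) (m : ℕ) :
    rowDet w (colVec k (addRims l k m nu)) =
      ((-1) ^ (k - 1) * c) ^ m * rowDet w (colVec k nu) := by
  induction m with
  | zero => simp [addRims]
  | succ m ih =>
    rw [addRims_succ, rowDet_addFullRim hk hn (h.isCylindric_addRims hk m), ih, pow_succ']
    ring

/-- The general form of the quantum Pieri expansion. -/
theorem prod_elemCoeff_mul_rowDet_eq_sum_quantumKostka (hk : 0 < k) {w : ℕ → Fin k → R}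
    {M : Matrix (Fin k) (Fin k) R} {c : R}
    (hw : ∀ a, w (a + 1) = Matrix.vecMul (w a) M) (hn : ∀ a, w (a + (l + k)) = c • w a)
    {r : ℕ} (mu : Fin r → ℕ) {lam : YoungDiagram} (hlam : InBox l k lam) :
    (∏ i, elemCoeff M (mu i)) * rowDet w (colVec k lam) =
      ∑ nu ∈ boxShapes l k,
        ∑ m ∈ (Finset.range (lam.card + (∑ i, mu i) + 1)).filter
            (fun m => nu.card + m * (l + k) = lam.card + ∑ i, mu i),
          (quantumKostka l k lam mu nu m : R) * ((-1) ^ (k - 1) * c) ^ m *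
            rowDet w (colVec k nu) := by
  rw [prod_elemCoeff_mul_rowDet hw hn mu (hlam.isCylindric hk), sum_cylindricShapes hk]
  refine Finset.sum_congr rfl fun nu hnu => Finset.sum_congr rfl fun m _ => ?_
  rw [quantumKostka_eq_tableauCount, rowDet_addRims hk hn (mem_boxShapes.1 hnu), mul_assoc]

end RimReduction

/-! ### Independence of the order of μ, via the group ring of (ℤ/n)^k -/

section OrderIndependence

theorem InBox.colLen_le {l k : ℕ} {nu : YoungDiagram} (h : InBox l k nu) (j : ℕ) :
    nu.colLen j ≤ l := by
  by_contra hlt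
  have := h ((YoungDiagram.mem_cells _).2 (YoungDiagram.mem_iff_lt_colLen.2 (not_le.1 hlt)))
  simp at this

theorem colVec_lt_of_lt {k : ℕ} (nu : YoungDiagram) {i j : Fin k} (h : i < j) :
    colVec k nu j < colVec k nu i := by
  have h1 : (i : ℕ) < j := h
  have h2 := nu.colLen_anti i j h1.le
  have h3 := j.2
  simp only [colVec]
  omega

theorem colVec_injective (k : ℕ) (nu : YoungDiagram) : Function.Injective (colVec k nu) := by
  intro i j h
  rcases lt_trichotomy i j with h1 | h1 | h1
  · exact absurd h (colVec_lt_of_lt nu h1).ne'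
  · exact h1
  · exact absurd h (colVec_lt_of_lt nu h1).ne

/-- A strictly decreasing sequence is determined by its set of values. -/
theorem InBox.eq_of_colVec_perm {l k : ℕ} (hk : 0 < k) {nu nu' : YoungDiagram} (h : InBox l k nu)
    (h' : InBox l k nu') (s : Equiv.Perm (Fin k))
    (hs : ∀ i, colVec k nu (s i) = colVec k nu' i) : nu = nu' ∧ s = 1 := by
  have h1 : StrictAnti (colVec k nu) := fun i j => colVec_lt_of_lt nu
  have h2 : StrictAnti (colVec k nu') := fun i j => colVec_lt_of_lt nu'
  have h3 : colVec k nu = colVec k nu' := by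
    rw [← h1.range_inj h2, ← s.surjective.range_comp]
    congr 1
    ext i
    exact hs i
  have h4 : ∀ i, colVec k nu i = colVec k nu' i := fun i => congrFun h3 i
  refine ⟨ext_colLen fun j => ?_, Equiv.ext fun i => ?_⟩
  · by_cases hj : j < k
    · have := h4 ⟨j, hj⟩
      simpa [colVec] using this
    · rw [(h.isCylindric hk).colLen_eq_zero (not_lt.1 hj),
        (h'.isCylindric hk).colLen_eq_zero (not_lt.1 hj)]
  · exact colVec_injective k nu ((hs i).trans (h4 i).symm)

/-- The powers of the generators of the group ring of `(ℤ/n)^k`. -/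
noncomputable def torsionPower (n k : ℕ) (a : ℕ) (i : Fin k) :
    AddMonoidAlgebra ℤ (Fin k → ZMod n) :=
  AddMonoidAlgebra.single (Pi.single i (a : ZMod n)) 1

theorem torsionPower_succ (n k a : ℕ) : torsionPower n k (a + 1) =
    Matrix.vecMul (torsionPower n k a) (Matrix.diagonal (torsionPower n k 1)) := by
  ext1 i
  rw [Matrix.vecMul_diagonal, torsionPower, torsionPower, torsionPower,
    AddMonoidAlgebra.single_mul_single, ← Pi.single_add]
  simp

theorem torsionPower_add (n k a : ℕ) :
    torsionPower n k (a + n) = (1 : AddMonoidAlgebra ℤ (Fin k → ZMod n)) • torsionPower n k a := by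
  ext1 i
  simp [torsionPower]

/-- For shapes in the box all exponents are below `l + k`, so reduction modulo `l + k` loses
nothing. Only the identity term of the alternant of `nu` has decreasing exponents. -/
theorem coeff_rowDet_torsionPower {l k : ℕ} (hk : 0 < k) {nu nu' : YoungDiagram}
    (h : InBox l k nu) (h' : InBox l k nu') :
    (rowDet (torsionPower (l + k) k) (colVec k nu)).coeff
      (fun i => (colVec k nu' i : ZMod (l + k))) =
      open Classical in if nu = nu' then 1 else 0 := by
  have hlt : ∀ {rho : YoungDiagram}, InBox l k rho → ∀ i, colVec k rho i < l + k := by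
    intro rho hrho i
    have h1 := hrho.colLen_le i
    have h2 := i.2
    simp only [colVec]
    omega
  rw [rowDet, Matrix.det_apply, AddMonoidAlgebra.coeff_sum, Finsupp.finsetSum_apply]
  have hterm : ∀ s : Equiv.Perm (Fin k),
      (Equiv.Perm.sign s • ∏ i, (Matrix.of fun j => torsionPower (l + k) k (colVec k nu j))
        (s i) i).coeff (fun i => (colVec k nu' i : ZMod (l + k))) =
      (Equiv.Perm.sign s : ℤ) * if ∀ i, colVec k nu (s i) = colVec k nu' i then 1 else 0 := by
    intro s
    simp only [Matrix.of_apply, torsionPower]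
    rw [AddMonoidAlgebra.prod_single, Units.smul_def, AddMonoidAlgebra.coeff_smul_apply,
      Finset.univ_sum_single (fun i => ((colVec k nu (s i) : ℕ) : ZMod (l + k))),
      Finset.prod_const_one, AddMonoidAlgebra.coeff_single, Finsupp.single_apply, smul_eq_mul]
    congr 1
    refine if_congr ?_ rfl rfl
    rw [funext_iff]
    refine forall_congr' fun i => ?_
    rw [ZMod.natCast_eq_natCast_iff', Nat.mod_eq_of_lt (hlt h _), Nat.mod_eq_of_lt (hlt h' _)]
  rw [Finset.sum_congr rfl fun s _ => hterm s]
  split_ifs with hnu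
  · subst hnu
    rw [Finset.sum_eq_single 1]
    · simp
    · intro s _ hs
      rw [if_neg, mul_zero]
      exact fun hs' => hs (h.eq_of_colVec_perm hk h s hs').2
    · simp
  · refine Finset.sum_eq_zero fun s _ => ?_
    rw [if_neg, mul_zero]
    exact fun hs' => hnu (h.eq_of_colVec_perm hk h' s hs').1

/-- The right-hand side depends on `mu` only through a product over its entries, which makes the
symmetry visible. -/
theorem quantumKostka_eq_coeff {l k : ℕ} (hk : 0 < k) {lam : YoungDiagram} (hlam : InBox l k lam)
    {r : ℕ} (mu : Fin r → ℕ) {nu : YoungDiagram} (hnu : InBox l k nu) (m : ℕ)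
    (hm : nu.card + m * (l + k) = lam.card + ∑ i, mu i) :
    (quantumKostka l k lam mu nu m : ℤ) = (((-1) ^ (k - 1)) ^ m) *
      ((∏ i, elemCoeff (Matrix.diagonal (torsionPower (l + k) k 1)) (mu i)) *
        rowDet (torsionPower (l + k) k) (colVec k lam)).coeff
          (fun i => (colVec k nu i : ZMod (l + k))) := by
  classical
  rw [prod_elemCoeff_mul_rowDet_eq_sum_quantumKostka hk (torsionPower_succ (l + k) k)
    (torsionPower_add (l + k) k) mu hlam, AddMonoidAlgebra.coeff_sum, Finsupp.finsetSum_apply,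
    Finset.sum_eq_single nu]
  · have hf : (Finset.range (lam.card + (∑ i, mu i) + 1)).filter
        (fun m => nu.card + m * (l + k) = lam.card + ∑ i, mu i) = {m} := by
      ext m'
      simp only [Finset.mem_filter, Finset.mem_range, Finset.mem_singleton]
      constructor
      · rintro ⟨-, h⟩
        have : m' * (l + k) = m * (l + k) := by omega
        exact Nat.eq_of_mul_eq_mul_right (by omega) this
      · rintro rfl
        have : m' ≤ m' * (l + k) := Nat.le_mul_of_pos_right _ (by omega)
        exact ⟨by omega, hm⟩
    rw [hf, Finset.sum_singleton]
    have h1 : (quantumKostka l k lam mu nu m : AddMonoidAlgebra ℤ (Fin k → ZMod (l + k))) *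
        ((-1) ^ (k - 1) * 1) ^ m * rowDet (torsionPower (l + k) k) (colVec k nu) =
        ((quantumKostka l k lam mu nu m : ℤ) * ((-1) ^ (k - 1)) ^ m) •
          rowDet (torsionPower (l + k) k) (colVec k nu) := by
      rw [zsmul_eq_mul]
      push_cast
      rw [mul_one]
    rw [h1, AddMonoidAlgebra.coeff_smul_apply, coeff_rowDet_torsionPower hk hnu hnu, if_pos rfl,
      smul_eq_mul, mul_one, mul_left_comm, ← mul_pow, ← mul_pow]
    simp
  · intro rho hrho hne
    rw [AddMonoidAlgebra.coeff_sum, Finsupp.finsetSum_apply]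
    refine Finset.sum_eq_zero fun m' _ => ?_
    have h1 : (quantumKostka l k lam mu rho m' : AddMonoidAlgebra ℤ (Fin k → ZMod (l + k))) *
        ((-1) ^ (k - 1) * 1) ^ m' * rowDet (torsionPower (l + k) k) (colVec k rho) =
        ((quantumKostka l k lam mu rho m' : ℤ) * ((-1) ^ (k - 1)) ^ m') •
          rowDet (torsionPower (l + k) k) (colVec k rho) := by
      rw [zsmul_eq_mul]
      push_cast
      rw [mul_one]
    rw [h1, AddMonoidAlgebra.coeff_smul_apply,
      coeff_rowDet_torsionPower hk (mem_boxShapes.1 hrho) hnu, if_neg hne, smul_zero]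
  · intro h
    exact absurd (mem_boxShapes.2 hnu) h

theorem quantumKostka_comp_perm {l k : ℕ} (hk : 0 < k) {lam : YoungDiagram}
    (hlam : InBox l k lam) {r : ℕ} (mu : Fin r → ℕ) {nu : YoungDiagram} (hnu : InBox l k nu) (m : ℕ)
    (hm : nu.card + m * (l + k) = lam.card + ∑ i, mu i) (e : Equiv.Perm (Fin r)) :
    quantumKostka l k lam (fun i => mu (e i)) nu m = quantumKostka l k lam mu nu m := by
  have h : (quantumKostka l k lam (fun i => mu (e i)) nu m : ℤ) = quantumKostka l k lam mu nu m := by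
    rw [quantumKostka_eq_coeff hk hlam (fun i => mu (e i)) hnu m
      (hm.trans (by rw [Equiv.sum_comp e mu])), quantumKostka_eq_coeff hk hlam mu hnu m hm,
      Equiv.prod_comp e fun i => elemCoeff (Matrix.diagonal (torsionPower (l + k) k 1)) (mu i)]
  exact_mod_cast h

end OrderIndependence

/-! ### Quasi-periodic windows of the dual series -/

section DualRecurrence

variable {R : Type*} [CommRing R] {k : ℕ}

/-- The vectors `(h_{a-k+1}, …, h_a)` of consecutive coefficients. -/
noncomputable def coeffWindow (k : ℕ) (h : PowerSeries R) (a : ℕ) (i : Fin k) : R :=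
  zCoeff h ((a : ℤ) - ((k - 1 : ℕ) : ℤ) + i)

/-- The companion matrix of the recurrence with the coefficients of `f`. -/
noncomputable def recurrenceMatrix (k : ℕ) (f : PowerSeries R) : Matrix (Fin k) (Fin k) R :=
  Matrix.of fun i j =>
    if (j : ℕ) = k - 1 then (-1) ^ (k - 1 - (i : ℕ)) * PowerSeries.coeff (k - i) f
    else if (i : ℕ) = j + 1 then 1 else 0

theorem recurrence_of_mul_evalNegHom_eq_one {f h : PowerSeries R}
    (hf : ∀ i, k < i → PowerSeries.coeff i f = 0)
    (hfh : f * PowerSeries.evalNegHom h = 1) {m : ℕ} (hm : 0 < m) :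
    ∑ t ∈ Finset.range (k + 1), (-1) ^ t * PowerSeries.coeff t f * zCoeff h ((m : ℤ) - t) = 0 := by
  have h1 : ∑ t ∈ Finset.range (m + 1),
      (-1) ^ t * PowerSeries.coeff t f * zCoeff h ((m : ℤ) - t) = 0 := by
    have h2 := congrArg (PowerSeries.coeff m) hfh
    rw [PowerSeries.coeff_mul, Finset.Nat.sum_antidiagonal_eq_sum_range_succ_mk,
      PowerSeries.coeff_one, if_neg hm.ne'] at h2
    have h3 := congrArg (fun x => (-1) ^ m * x) h2
    simp only [mul_zero, Finset.mul_sum] at h3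
    rw [← h3]
    refine Finset.sum_congr rfl fun t ht => ?_
    have htm : t ≤ m := by
      rw [Finset.mem_range] at ht
      omega
    rw [PowerSeries.evalNegHom, PowerSeries.coeff_rescale,
      show (m : ℤ) - t = ((m - t : ℕ) : ℤ) by omega, zCoeff_natCast]
    obtain ⟨d, rfl⟩ := Nat.exists_eq_add_of_le htm
    rw [Nat.add_sub_cancel_left, pow_add]
    have : ((-1 : R) ^ d) * (-1) ^ d = 1 := by
      rw [← mul_pow]; simp
    linear_combination (-((-1) ^ t * PowerSeries.coeff t f * PowerSeries.coeff d h)) * this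
  have e1 : ∀ N, m ≤ N → ∑ t ∈ Finset.range (N + 1),
      (-1) ^ t * PowerSeries.coeff t f * zCoeff h ((m : ℤ) - t) = 0 := by
    intro N hN
    rw [← h1]
    symm
    apply Finset.sum_subset (Finset.range_mono (by omega))
    intro t _ ht
    rw [Finset.mem_range] at ht
    rw [zCoeff_of_neg _ (by omega), mul_zero]
  -- Both ranges are compared inside `m + k + 1`: indices above `m` give negative coefficients of
  -- `h`, and indices above `k` are killed by `hf`.
  rw [← e1 (m + k) (by omega)]
  apply Finset.sum_subset (Finset.range_mono (by omega))
  intro t _ ht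
  rw [Finset.mem_range] at ht
  rw [hf t (by omega), mul_zero, zero_mul]

theorem coeffWindow_succ {f h : PowerSeries R} (hf0 : PowerSeries.coeff 0 f = 1)
    (hf : ∀ i, k < i → PowerSeries.coeff i f = 0)
    (hfh : f * PowerSeries.evalNegHom h = 1) (a : ℕ) :
    coeffWindow k h (a + 1) = Matrix.vecMul (coeffWindow k h a) (recurrenceMatrix k f) := by
  ext1 j
  simp only [Matrix.vecMul, dotProduct, recurrenceMatrix, Matrix.of_apply]
  have hj := j.2
  by_cases hjk : (j : ℕ) = k - 1
  · simp only [hjk, if_true]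
    have h1 := recurrence_of_mul_evalNegHom_eq_one hf hfh (Nat.succ_pos a)
    rw [Finset.sum_range_succ', hf0, ← Fin.sum_univ_eq_sum_range (fun t =>
      (-1) ^ (t + 1) * PowerSeries.coeff (t + 1) f * zCoeff h (((a + 1 : ℕ) : ℤ) - ((t + 1 : ℕ) : ℤ)))
      k, ← Equiv.sum_comp Fin.revPerm] at h1
    have h2 : ∀ i : Fin k, (-1) ^ ((Fin.revPerm i : ℕ) + 1) *
        PowerSeries.coeff ((Fin.revPerm i : ℕ) + 1) f *
        zCoeff h (((a + 1 : ℕ) : ℤ) - (((Fin.revPerm i : ℕ) + 1 : ℕ) : ℤ)) =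
        -(coeffWindow k h a i * ((-1) ^ (k - 1 - (i : ℕ)) * PowerSeries.coeff (k - i) f)) := by
      intro i
      have hi := i.2
      rw [Fin.revPerm_apply, Fin.val_rev, show k - ((i : ℕ) + 1) = k - 1 - i by omega,
        show k - 1 - (i : ℕ) + 1 = k - i by omega, coeffWindow,
        show ((a + 1 : ℕ) : ℤ) - ((k - (i : ℕ) : ℕ) : ℤ) = (a : ℤ) - ((k - 1 : ℕ) : ℤ) + i by omega,
        show k - (i : ℕ) = k - 1 - i + 1 by omega, pow_succ]
      ring
    rw [Finset.sum_congr rfl fun i _ => h2 i, Finset.sum_neg_distrib] at h1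
    have h3 : coeffWindow k h (a + 1) j = zCoeff h (((a + 1 : ℕ) : ℤ) - ((0 : ℕ) : ℤ)) := by
      rw [coeffWindow]
      congr 1
      omega
    rw [h3]
    linear_combination h1
  · simp only [hjk, if_false]
    rw [Finset.sum_eq_single ⟨j + 1, by omega⟩]
    · simp only [if_true, mul_one, coeffWindow]
      congr 1
      push_cast
      ring
    · intro i _ hi
      rw [if_neg, mul_zero]
      exact fun h => hi (Fin.ext h)
    · simp

/-- The window at `0` is `(0, …, 0, 1)` and the window at `l + k` is `(0, …, 0, c)`; the linear
recurrence propagates this proportionality. -/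
theorem coeffWindow_add {l : ℕ} (hk : 0 < k) {f h : PowerSeries R}
    (hf0 : PowerSeries.coeff 0 f = 1) (hf : ∀ i, k < i → PowerSeries.coeff i f = 0)
    (hfh : f * PowerSeries.evalNegHom h = 1) {c : R}
    (hzero : ∀ p, l + 1 ≤ p → p ≤ l + k - 1 → PowerSeries.coeff p h = 0)
    (hc : PowerSeries.coeff (l + k) h = c) (a : ℕ) :
    coeffWindow k h (a + (l + k)) = c • coeffWindow k h a := by
  induction a with
  | zero =>
    have h0 : PowerSeries.coeff 0 h = 1 := by
      have := congrArg (PowerSeries.coeff 0) hfh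
      rw [PowerSeries.coeff_mul, Finset.Nat.antidiagonal_zero, Finset.sum_singleton, hf0,
        one_mul] at this
      simpa [PowerSeries.evalNegHom, PowerSeries.coeff_rescale] using this
    ext1 i
    have hi := i.2
    rw [Pi.smul_apply, smul_eq_mul, coeffWindow, coeffWindow,
      show ((0 + (l + k) : ℕ) : ℤ) - ((k - 1 : ℕ) : ℤ) + i = ((l + 1 + i : ℕ) : ℤ) by omega,
      zCoeff_natCast]
    by_cases hik : (i : ℕ) = k - 1
    · rw [show l + 1 + (i : ℕ) = l + k by omega, hc,
        show ((0 : ℕ) : ℤ) - ((k - 1 : ℕ) : ℤ) + i = ((0 : ℕ) : ℤ) by omega, zCoeff_natCast, h0,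
        mul_one]
    · rw [hzero _ (by omega) (by omega), zCoeff_of_neg _ (by omega), mul_zero]
  | succ a ih =>
    rw [show a + 1 + (l + k) = a + (l + k) + 1 by ring, coeffWindow_succ hf0 hf hfh, ih,
      Matrix.smul_vecMul, ← coeffWindow_succ hf0 hf hfh]

theorem rowDet_coeffWindow {f h : PowerSeries R} (hf0 : PowerSeries.coeff 0 f = 1)
    (hfh : f * PowerSeries.evalNegHom h = 1) {lam : YoungDiagram} (hw : ∀ x ∈ lam.cells, x.2 < k)
    {r : ℕ} (hr : lam.colLen 0 ≤ r) :
    rowDet (coeffWindow k h) (colVec k lam) =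
      Matrix.det (Matrix.of fun i j : Fin r => zCoeff f ((lam.rowLen i : ℤ) + j - i)) := by
  have hc : lam.rowLen 0 ≤ k := by
    by_contra hlt
    have := hw _ ((YoungDiagram.mem_cells _).2 (YoungDiagram.mem_iff_lt_rowLen.2 (not_le.1 hlt)))
    simp at this
  rw [det_rowLen_eq_det_colLen hf0 hfh r k lam hr hc, rowDet]
  congr 1
  ext i j
  simp only [Matrix.of_apply, coeffWindow, colVec]
  congr 1
  have := i.2
  omega

/-- The Pieri rule for the empty diagram avoids computing a characteristic polynomial: the only
strip of `p` boxes is a single row, whose Jacobi–Trudi determinant is one coefficient of `f`. -/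
theorem elemCoeff_recurrenceMatrix {l : ℕ} (hl : 0 < l) (hk : 0 < k) {f h : PowerSeries R}
    (hf0 : PowerSeries.coeff 0 f = 1) (hf : ∀ i, k < i → PowerSeries.coeff i f = 0)
    (hfh : f * PowerSeries.evalNegHom h = 1) {c : R}
    (hn : ∀ a, coeffWindow k h (a + (l + k)) = c • coeffWindow k h a) {p : ℕ} (hp : p ≤ k) :
    elemCoeff (recurrenceMatrix k f) p = PowerSeries.coeff p f := by
  have hbot : IsCylindric l k ⊥ := InBox.isCylindric hk (by simp [InBox])
  have hcol0 : ∀ j, (⊥ : YoungDiagram).colLen j = 0 := fun j =>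
    colLen_eq_of_mem_iff fun i => by simp
  have h1 := sum_stripSuccs_rowDet (coeffWindow_succ hf0 hf hfh) hn hbot p
  rw [rowDet_coeffWindow hf0 hfh hbot.1 (r := 0) (by rw [hcol0]), Matrix.det_fin_zero,
    mul_one] at h1
  have hanti : ∀ i j, i ≤ j → j < k → (if j < p then 1 else 0) ≤ if i < p then 1 else 0 := by
    intro i j hij _
    split_ifs <;> omega
  set tau := ofColLens k (fun j => if j < p then 1 else 0) hanti with htau
  have hcl : ∀ j, tau.colLen j = if j < p then 1 else 0 := by
    intro j
    rw [htau, colLen_ofColLens]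
    split_ifs <;> omega
  -- For `0 < p < k` the first column has one box and the k-th none, so `0 < l` is needed.
  have hcyl : IsCylindric l k tau := by
    refine ⟨width_ofColLens hanti, ?_⟩
    rw [hcl, hcl]
    split_ifs <;> omega
  have hrow : ∀ rho : YoungDiagram, rho.colLen 0 ≤ 1 → rho.card = rho.rowLen 0 := by
    intro rho hrho
    rw [YoungDiagram.rowLen_eq_card, YoungDiagram.card]
    congr 1
    ext ⟨i, j⟩
    rw [YoungDiagram.mem_cells, YoungDiagram.mem_row_iff, iff_self_and]
    intro hx
    have := YoungDiagram.mem_iff_lt_colLen.1 hx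
    have := rho.colLen_anti 0 j (Nat.zero_le _)
    simp only
    omega
  have hrl : tau.rowLen 0 = p := by
    apply rowLen_eq_of_mem_iff
    intro j
    rw [YoungDiagram.mem_iff_lt_colLen, hcl]
    split_ifs <;> simp [*]
  have hcard0 : (⊥ : YoungDiagram).card = 0 := rfl
  have hsing : stripSuccs l k p ⊥ = {tau} := by
    ext rho
    rw [mem_stripSuccs, Finset.mem_singleton, hcard0, zero_add]
    simp only [hcol0, zero_add, Nat.zero_le, true_and]
    constructor
    · rintro ⟨_, h2, h3⟩
      rw [hrow rho (h3 0)] at h2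
      apply ext_colLen
      intro j
      have h4 : 0 < rho.colLen j ↔ j < p := by
        rw [← YoungDiagram.mem_iff_lt_colLen, YoungDiagram.mem_iff_lt_rowLen, h2]
      have := h3 j
      rw [hcl]
      split_ifs <;> omega
    · rintro rfl
      refine ⟨hcyl, ?_, fun j => ?_⟩
      · rw [hrow _ (by rw [hcl]; split_ifs <;> omega), hrl]
      · rw [hcl]
        split_ifs <;> omega
  rw [hsing, Finset.sum_singleton, rowDet_coeffWindow hf0 hfh hcyl.1 (r := 1)
    (by rw [hcl]; split_ifs <;> omega)] at h1
  rw [← h1, Matrix.det_fin_one, Matrix.of_apply]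
  simp [hrl, zCoeff_natCast]

theorem mul_evalNegHom_evalNegHom_invOfUnit {f : PowerSeries R}
    (hf0 : PowerSeries.coeff 0 f = 1) :
    f * PowerSeries.evalNegHom (PowerSeries.evalNegHom (PowerSeries.invOfUnit f 1)) = 1 := by
  rw [PowerSeries.evalNegHom, PowerSeries.rescale_rescale, neg_mul_neg, one_mul,
    PowerSeries.rescale_one, RingHom.id_apply]
  apply PowerSeries.mul_invOfUnit
  rw [← PowerSeries.coeff_zero_eq_constantCoeff_apply, hf0, Units.val_one]

/-- The sign of the rotation of rows cancels the sign in the relation for `Y_n`, so each rim hook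
contributes exactly `q`. -/
theorem neg_one_pow_pred_mul_neg (hk : 0 < k) (x : R) :
    (-1) ^ (k - 1) * -((-1) ^ k * x) = x := by
  obtain ⟨j, rfl⟩ : ∃ j, k = j + 1 := ⟨k - 1, by omega⟩
  rw [Nat.add_sub_cancel, pow_succ]
  have : (-1 : R) ^ j * (-1) ^ j = 1 := by
    rw [← mul_pow]; simp
  linear_combination x * this

end DualRecurrence

/-! ### Specialization to Λ(l,k) -/

section QuantumRing

variable (l k : ℕ)

/-- The generating series of the classes `σ_i`. -/
noncomputable def sigmaSeries : PowerSeries (Lam l k) := PowerSeries.mk fun i => sigma l k i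

/-- The series dual to `sigmaSeries`. -/
noncomputable def dualSeries : PowerSeries (Lam l k) :=
  PowerSeries.evalNegHom (PowerSeries.invOfUnit (sigmaSeries l k) 1)

theorem coeff_zero_sigmaSeries : PowerSeries.coeff 0 (sigmaSeries l k) = 1 := by
  simp [sigmaSeries, sigma, sigmaPoly]

theorem coeff_sigmaSeries_of_lt {i : ℕ} (hi : k < i) :
    PowerSeries.coeff i (sigmaSeries l k) = 0 := by
  rw [sigmaSeries, PowerSeries.coeff_mk, sigma, sigmaPoly, if_neg (by omega), dif_neg (by omega),
    map_zero]

theorem zCoeff_sigmaSeries (i : ℤ) : zCoeff (sigmaSeries l k) i = sigma l k i := by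
  by_cases hi : 0 ≤ i
  · obtain ⟨n, rfl⟩ := Int.eq_ofNat_of_zero_le hi
    rw [zCoeff_natCast, sigmaSeries, PowerSeries.coeff_mk]
  · rw [zCoeff_of_neg _ (not_le.1 hi), sigma, sigmaPoly, if_neg (by omega), dif_neg (by omega),
      map_zero]

theorem sigmaSeries_mul_evalNegHom_dualSeries :
    sigmaSeries l k * PowerSeries.evalNegHom (dualSeries l k) = 1 :=
  mul_evalNegHom_evalNegHom_invOfUnit (coeff_zero_sigmaSeries l k)

/-- `Y k p` is the Jacobi–Trudi determinant of a single column of `p` boxes, and the dual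
determinant is `1 × 1`. -/
theorem mk_Y (p : ℕ) :
    Ideal.Quotient.mk (relations l k) (Y k p) = PowerSeries.coeff p (dualSeries l k) := by
  have hanti : ∀ i j, i ≤ j → j < 1 → (fun _ => p) j ≤ (fun _ : ℕ => p) i := fun _ _ _ _ => le_rfl
  set lam := ofColLens 1 (fun _ => p) hanti with hlam
  have hcl : ∀ j, lam.colLen j = if j < 1 then p else 0 := fun j => by
    rw [hlam, colLen_ofColLens]
  have hrl : ∀ i, i < p → lam.rowLen i = 1 := by
    intro i hi
    apply rowLen_eq_of_mem_iff
    intro j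
    rw [YoungDiagram.mem_iff_lt_colLen, hcl]
    split_ifs <;> omega
  have hrl0 : lam.rowLen 0 ≤ 1 := by
    by_contra h
    have := YoungDiagram.mem_iff_lt_colLen.1 (YoungDiagram.mem_iff_lt_rowLen.2 (not_le.1 h))
    rw [hcl] at this
    simp at this
  have key := det_rowLen_eq_det_colLen (coeff_zero_sigmaSeries l k)
    (sigmaSeries_mul_evalNegHom_dualSeries l k) p 1 lam (by rw [hcl]; simp) hrl0
  rw [Matrix.det_fin_one, Matrix.of_apply, hcl] at key
  simp only [Fin.val_zero, Nat.zero_lt_one, if_true] at key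
  rw [show (p : ℤ) + ((0 : ℕ) : ℤ) - ((0 : ℕ) : ℤ) = (p : ℕ) by omega, zCoeff_natCast] at key
  rw [← key]
  refine (RingHom.map_det (R := MvPolynomial (Fin k) (Polynomial ℤ)) (S := Lam l k)
    (Ideal.Quotient.mk (relations l k))
    (Matrix.of fun i j : Fin p => sigmaPoly k (1 + (j : ℤ) - (i : ℤ)))).trans ?_
  congr 1
  ext i j
  rw [RingHom.mapMatrix_apply, Matrix.map_apply, Matrix.of_apply, Matrix.of_apply,
    zCoeff_sigmaSeries, hrl _ i.2]
  rfl

theorem coeff_dualSeries_eq_zero {p : ℕ} (h1 : l + 1 ≤ p) (h2 : p ≤ l + k - 1) :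
    PowerSeries.coeff p (dualSeries l k) = 0 := by
  rw [← mk_Y, Ideal.Quotient.eq_zero_iff_mem]
  exact Ideal.subset_span (Or.inl ⟨p, h1, h2, rfl⟩)

theorem coeff_dualSeries_add :
    PowerSeries.coeff (l + k) (dualSeries l k) = -((-1) ^ k * q l k) := by
  have h : Ideal.Quotient.mk (relations l k) (Y k (l + k) + (-1) ^ k * qPoly k) = 0 :=
    Ideal.Quotient.eq_zero_iff_mem.2 (Ideal.subset_span (Or.inr rfl))
  rw [map_add, mk_Y, map_mul, map_pow, map_neg, map_one] at h
  exact eq_neg_of_add_eq_zero_left h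

variable {l k}

theorem rowDet_dualSeries {lam : YoungDiagram} (hw : ∀ x ∈ lam.cells, x.2 < k) :
    rowDet (coeffWindow k (dualSeries l k)) (colVec k lam) = sigmaShape l k lam := by
  rw [rowDet_coeffWindow (coeff_zero_sigmaSeries l k)
    (sigmaSeries_mul_evalNegHom_dualSeries l k) hw le_rfl, sigmaShape]
  simp_rw [zCoeff_sigmaSeries]

theorem prod_sigma_mul_sigmaShape (hl : 0 < l) (hk : 0 < k) {lam : YoungDiagram}
    (hlam : InBox l k lam) {r : ℕ} (mu : Fin r → ℕ) (hmu : ∀ i, mu i ≤ k) :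
    (∏ i, sigma l k (mu i)) * sigmaShape l k lam =
      ∑ nu ∈ boxShapes l k,
        ∑ m ∈ (Finset.range (lam.card + (∑ i, mu i) + 1)).filter
            (fun m => nu.card + m * (l + k) = lam.card + ∑ i, mu i),
          (quantumKostka l k lam mu nu m : Lam l k) * q l k ^ m * sigmaShape l k nu := by
  have hf0 := coeff_zero_sigmaSeries l k
  have hf : ∀ i, k < i → PowerSeries.coeff i (sigmaSeries l k) = 0 := fun i =>
    coeff_sigmaSeries_of_lt l k
  have hfh := sigmaSeries_mul_evalNegHom_dualSeries l k
  have hn := coeffWindow_add hk hf0 hf hfh (fun p => coeff_dualSeries_eq_zero l k)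
    (coeff_dualSeries_add l k)
  have key := prod_elemCoeff_mul_rowDet_eq_sum_quantumKostka hk
    (coeffWindow_succ hf0 hf hfh) hn mu hlam
  have hprod : ∏ i, elemCoeff (recurrenceMatrix k (sigmaSeries l k)) (mu i) =
      ∏ i, sigma l k (mu i) := by
    refine Finset.prod_congr rfl fun i _ => ?_
    rw [elemCoeff_recurrenceMatrix hl hk hf0 hf hfh hn (hmu i), ← zCoeff_natCast,
      zCoeff_sigmaSeries]
  have hc : (-1 : Lam l k) ^ (k - 1) * -((-1) ^ k * q l k) = q l k :=
    neg_one_pow_pred_mul_neg (R := Lam l k) hk _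
  rw [hprod, rowDet_dualSeries (hlam.isCylindric hk).1, hc] at key
  rw [key]
  refine Finset.sum_congr rfl fun nu hnu => Finset.sum_congr rfl fun m _ => ?_
  rw [rowDet_dualSeries ((mem_boxShapes.1 hnu).isCylindric hk).1]

end QuantumRing

end QuantumKostka

theorem mainTheorem2 (l k : ℕ) (hl : 0 < l) (hk : 0 < k)
    (lam : YoungDiagram) (hlam : QuantumKostka.InBox l k lam)
    (r : ℕ) (mu : Fin r → ℕ) (hmu : ∀ i, mu i ≤ k) :
    ((∏ i, QuantumKostka.sigma l k (mu i)) * QuantumKostka.sigmaShape l k lam =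
      ∑ nu ∈ QuantumKostka.boxShapes l k,
        ∑ m ∈ (Finset.range (lam.card + (∑ i, mu i) + 1)).filter
            (fun m => nu.card + m * (l + k) = lam.card + ∑ i, mu i),
          (QuantumKostka.quantumKostka l k lam mu nu m : QuantumKostka.Lam l k) *
            QuantumKostka.q l k ^ m * QuantumKostka.sigmaShape l k nu) ∧
    (∀ (nu : YoungDiagram) (m : ℕ), QuantumKostka.InBox l k nu →
      nu.card + m * (l + k) = lam.card + ∑ i, mu i →
      ∀ e : Equiv.Perm (Fin r),
        QuantumKostka.quantumKostka l k lam (fun i => mu (e i)) nu m =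
          QuantumKostka.quantumKostka l k lam mu nu m) := by
  exact ⟨QuantumKostka.prod_sigma_mul_sigmaShape hl hk hlam mu hmu, fun nu m hnu hm e =>
    QuantumKostka.quantumKostka_comp_perm hk hlam mu hnu m hm e⟩
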